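/- Let $\mathcal H$ be a separable real Hilbert space and let $f:\mathcal H\to\,]-\infty,+\infty]$ be proper, lower semicontinuous and convex. Let $\Omega_P\subset\mathbb R^m$, let $\xi$ be a random vector with values in $\Omega_P$, and let $H:\mathcal H\times\Omega_P\to\mathbb R$ be convex in its first variable with $H(x,\xi)$ integrable for every $x$. Suppose that $h(x)=\mathsf E_\xi[H(x,\xi)]$ is convex and differentiable on $\mathcal H$ with $\mu$-Lipschitz gradient ($\mu\ge 0$), and that $$\operatorname{zer}(\partial f+\nabla h)=\{x\in\mathcal H: 0\in\partial f(x)+\nabla h(x)\}\neq\varnothing .$$ Let $(\xi_n)_{n\in\mathbb N}$ be i.i.d. copies of $\xi$ on a probability space $(\Omega,\mathcal F,\mathsf P)$, and let $\nabla H:\mathcal H\times\Omega_P\to\mathcal H$ be a (jointly measurable) stochastic gradient such that, for every $x\in\mathcal H$, $\nabla H(x,\xi)$ is integrable and $\mathsf E[\nabla H(x,\xi)]=\nabla h(x)$. Let $(\gamma_n)_{n\in\mathbb N}$ be a sequence in $]0,+\infty[$, let $x_0,x_{-1}\in\mathcal H$, and for every $n\in\mathbb N$ set $$y_n=2x_n-x_{n-1},\qquad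 x_{n+1}=\operatorname{prox}_{\gamma_n f}\big(x_n-\gamma_n\nabla H(y_n,\xi_n)\big),$$ where $\operatorname{prox}_{g}(u)=\operatorname{argmin}_{p\in\mathcal H}\big(g(p)+\tfrac12\|u-p\|^2\big)$. Below, conditional expectations of nonnegative random variables are understood in $[0,+\infty]$. Then the following hold. (i) Suppose that $\partial f$ is $\nu$-strongly monotone for some $\nu>0$, i.e. $\langle x-y,u-v\rangle\ge\nu\|x-y\|^2$ whenever $u\in\partial f(x)$ and $v\in\partial f(y)$, that there is a constant $c<+\infty$ such that, for every $n\in\mathbb N$, $$\mathsf E\big[\|\nabla H(y_n,\xi_n)-\nabla h(y_n)\|^2\,\big|\,\xi_0,\dots,\xi_{n-1}\big]\le c\quad\text{a.s.},$$ and that $\gamma_n=\frac{1}{2\nu(n+1)}$ for every $n\in\mathbb N$. Then $f+h$ has a unique minimizer $\overline x$ and, with $n_0$ the smallest integer such that $n_0>2\nu^{-1}\mu(1+\sqrt2)$, there is a constant $C$ such that for all $n>n_0$ the variable $\|x_n-\overline x\|^2$ is integrable and $$\mathsf E\big[\|x_n-\overline x\|^2\big]\le C\,\frac{\log(n+1)}{n+1}.$$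 (ii) Suppose (without any strong monotonicity assumption) that $(\gamma_n)_{n\in\mathbb N}$ is nondecreasing, that $\gamma_n\mu<\sqrt2-1$ for every $n\in\mathbb N$, that $$\tau=\inf_{n\ge1}\Big(\frac{2}{\gamma_n}-\frac1{\gamma_{n-1}}-\mu(1+\sqrt2)\Big)>0,$$ and that $$\sum_{n\in\mathbb N}\mathsf E\big[\|\nabla H(y_n,\xi_n)-\nabla h(y_n)\|^2\,\big|\,\xi_0,\dots,\xi_{n-1}\big]<+\infty\quad\text{a.s.}$$ Then there is a random variable $\overline x:\Omega\to\operatorname{zer}(\partial f+\nabla h)$ such that $(x_n)_{n\in\mathbb N}$ converges weakly to $\overline x$ almost surely. -/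

import Mathlib

open MeasureTheory ProbabilityTheory Filter Topology Set
open scoped ENNReal NNReal Gradient RealInnerProductSpace

/-- The class of proper, lower semicontinuous, convex functions from `E` to `]-∞, +∞]`.
In the convexity inequality the weights are strictly positive, so that no product `0 * ⊤` occurs,
and no sum `⊤ + ⊥` occurs since `f` never takes the value `⊥`. -/
structure IsGammaZero {E : Type*} [NormedAddCommGroup E] [InnerProductSpace ℝ E]
    (f : E → EReal) : Prop where
  ne_bot : ∀ x, f x ≠ ⊥
  exists_ne_top : ∃ x, f x ≠ ⊤
  lsc : LowerSemicontinuous f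
  convex : ∀ x y : E, ∀ a b : ℝ, 0 < a → 0 < b → a + b = 1 →
    f (a • x + b • y) ≤ (a : EReal) * f x + (b : EReal) * f y

/-- The convex subdifferential `∂f(x) = {u | ∀ y, f(x) + ⟨y - x, u⟩ ≤ f(y)}`. -/
def subdifferential {E : Type*} [NormedAddCommGroup E] [InnerProductSpace ℝ E]
    (f : E → EReal) (x : E) : Set E :=
  {u | ∀ y, f x + ((⟪y - x, u⟫ : ℝ) : EReal) ≤ f y}

/-- A set-valued operator `A` on `E` is `ν`-strongly monotone. -/
def IsStronglyMonotone {E : Type*} [NormedAddCommGroup E] [InnerProductSpace ℝ E]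
    (ν : ℝ) (A : E → Set E) : Prop :=
  ∀ x y : E, ∀ u ∈ A x, ∀ v ∈ A y, ν * ‖x - y‖ ^ 2 ≤ ⟪x - y, u - v⟫

/-- The zero set `zer(A + B)` of the sum of a set-valued operator `A` and a single-valued
operator `B`. -/
def zerSum {E : Type*} [NormedAddCommGroup E] (A : E → Set E) (B : E → E) : Set E :=
  {x | ∃ u ∈ A x, u + B x = 0}

/-- `p = prox_f u`, that is, `p` minimizes `y ↦ f(y) + ‖u - y‖² / 2` over the whole space. -/
def IsProx {E : Type*} [NormedAddCommGroup E] (f : E → EReal) (u p : E) : Prop :=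
  IsMinOn (fun y => f y + ((‖u - y‖ ^ 2 / 2 : ℝ) : EReal)) univ p

/-- The reflected points `y n = 2 x n - x (n - 1)`, where `xm1` plays the role of `x (-1)`. -/
def reflected {E Ω : Type*} [NormedAddCommGroup E] [NormedSpace ℝ E]
    (xm1 : E) (x : ℕ → Ω → E) : ℕ → Ω → E
  | 0, ω => (2 : ℝ) • x 0 ω - xm1
  | n + 1, ω => (2 : ℝ) • x (n + 1) ω - x n ω

/-- The σ-algebra `σ(ξ 0, …, ξ (n - 1))` (the trivial one when `n = 0`). -/
abbrev pastSigma {Ω S : Type*} [MeasurableSpace S] (ξ : ℕ → Ω → S) (n : ℕ) : MeasurableSpace Ω :=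
  ⨆ k : Fin n, MeasurableSpace.comap (ξ k) inferInstance

/-!
The energy of an iterate `x (n + 1)` relative to a zero `z` of `∂f + ∇h` is its squared distance to
`z`, weighted by `1 / γ n`, plus an inner product left over from telescoping the forward steps and
two quadratic terms in the increments that dominate it (`reflectedEnergy`,
`half_mul_norm_sq_le_reflectedEnergy`). Monotonicity of `∂f` at consecutive iterates, monotonicity
of `∇h` at the reflected point, and the Lipschitz bound show that the energy decreases along the
iteration up to inner products of `x (n + 2)` with the error of the stochastic gradient
(`reflectedEnergy_succ_le`). These products are harmless on average: replacing `x (n + 2)` by the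
outcome of a noiseless step costs a multiple of the squared error, because proximal operators are
nonexpansive, and the noiseless step is uncorrelated with the error
(`IsReflectedIteration.neg_setIntegral_inner_le`).

If `∂f` is strongly monotone, the weight of the squared distance in the energy can grow by `2 ν`
in each step (`reflectedEnergy_succ_le_of_stronglyMonotone`), while the expected contribution of the
noise is of order `1 / n`. Summation gives the bound of order `log n / n`
(`IsReflectedIteration.integral_norm_sub_sq_le`).

In the general case the energies form an almost supermartingale. The conditional variances are
summable only almost surely and need not be integrable, so the Robbins–Siegmund argument
(`ae_tendsto_and_summable_of_almost_supermartingale`) is applied to the process killed as soon as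
their sum exceeds a constant `K`, for every natural number `K`. Hence, almost surely, the
energies relative to a countable dense set of zeros converge, while increments and noise vanish
(`IsReflectedIteration.ae_tendsto_reflectedEnergy`). The distances to all zeros then converge, and
weak cluster points are zeros because the graph of `∂f + ∇h` is closed (`mem_zerSum_of_tendsto`);
Opial's lemma gives weak convergence. The limit is measurable because inner products with a dense
sequence embed the space measurably into `ℕ → ℝ` (`exists_measurable_weak_limit`).
-/

/-! ### Subdifferentials, minimizers and proximal points -/

lemma neg_mem_of_mem_zerSum {E : Type*} [NormedAddCommGroup E] {A : E → Set E} {B : E → E} {z : E}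
    (hz : z ∈ zerSum A B) : -B z ∈ A z := by
  obtain ⟨u, hu, hu0⟩ := hz
  rwa [← eq_neg_of_add_eq_zero_left hu0]

section ConvexAnalysis

variable {E : Type*} [NormedAddCommGroup E] [InnerProductSpace ℝ E]

namespace IsGammaZero

variable {f : E → EReal}

lemma coe_toReal_eq (hf : IsGammaZero f) {x : E} (hx : f x ≠ ⊤) :
    ((f x).toReal : EReal) = f x :=
  EReal.coe_toReal hx (hf.ne_bot x)

lemma le_coe_iff (hf : IsGammaZero f) {x : E} {t : ℝ} :
    f x ≤ (t : EReal) ↔ f x ≠ ⊤ ∧ (f x).toReal ≤ t := by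
  constructor
  · intro h
    have hx : f x ≠ ⊤ := ne_top_of_le_ne_top (EReal.coe_ne_top t) h
    refine ⟨hx, ?_⟩
    rwa [← hf.coe_toReal_eq hx, EReal.coe_le_coe_iff] at h
  · rintro ⟨hx, h⟩
    rwa [← hf.coe_toReal_eq hx, EReal.coe_le_coe_iff]

lemma toReal_convex (hf : IsGammaZero f) {x y : E} (hx : f x ≠ ⊤) (hy : f y ≠ ⊤) {a b : ℝ}
    (ha : 0 < a) (hb : 0 < b) (hab : a + b = 1) :
    f (a • x + b • y) ≠ ⊤ ∧
      (f (a • x + b • y)).toReal ≤ a * (f x).toReal + b * (f y).toReal := by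
  have h := hf.convex x y a b ha hb hab
  rw [← hf.coe_toReal_eq hx, ← hf.coe_toReal_eq hy, ← EReal.coe_mul, ← EReal.coe_mul,
    ← EReal.coe_add] at h
  exact hf.le_coe_iff.1 h

lemma mem_subdifferential_iff (hf : IsGammaZero f) {x u : E} :
    u ∈ subdifferential f x ↔
      f x ≠ ⊤ ∧ ∀ y, f y ≠ ⊤ → (f x).toReal + ⟪y - x, u⟫ ≤ (f y).toReal := by
  constructor
  · intro h
    have hx : f x ≠ ⊤ := by
      intro hx
      obtain ⟨y, hy⟩ := hf.exists_ne_top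
      have := h y
      rw [hx, EReal.top_add_coe, top_le_iff] at this
      exact hy this
    refine ⟨hx, fun y hy => ?_⟩
    have := h y
    rwa [← hf.coe_toReal_eq hx, ← hf.coe_toReal_eq hy, ← EReal.coe_add,
      EReal.coe_le_coe_iff] at this
  · rintro ⟨hx, h⟩ y
    by_cases hy : f y = ⊤
    · simp [hy]
    · rw [← hf.coe_toReal_eq hx, ← hf.coe_toReal_eq hy, ← EReal.coe_add, EReal.coe_le_coe_iff]
      exact h y hy

lemma subdifferential_monotone (hf : IsGammaZero f) {x y u v : E}
    (hu : u ∈ subdifferential f x) (hv : v ∈ subdifferential f y) : 0 ≤ ⟪x - y, u - v⟫ := by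
  rw [hf.mem_subdifferential_iff] at hu hv
  have h1 := hu.2 y hv.1
  have h2 := hv.2 x hu.1
  have h3 : ⟪y - x, u⟫ = -⟪x - y, u⟫ := by rw [← inner_neg_left, neg_sub]
  rw [inner_sub_right]
  linarith

lemma isMinOn_mul_add_iff (hf : IsGammaZero f) {a : ℝ} (ha : 0 < a) (k : E → ℝ) (p : E) :
    IsMinOn (fun y => (a : EReal) * f y + (k y : EReal)) univ p ↔
      f p ≠ ⊤ ∧ ∀ y, f y ≠ ⊤ → a * (f p).toReal + k p ≤ a * (f y).toReal + k y := by
  have hval : ∀ y, f y ≠ ⊤ →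
      (a : EReal) * f y + (k y : EReal) = ((a * (f y).toReal + k y : ℝ) : EReal) := by
    intro y hy
    rw [EReal.coe_add, EReal.coe_mul, hf.coe_toReal_eq hy]
  have htop : ∀ y, f y = ⊤ → (a : EReal) * f y + (k y : EReal) = ⊤ := by
    intro y hy
    rw [hy, EReal.coe_mul_top_of_pos ha, EReal.top_add_coe]
  simp only [isMinOn_iff, mem_univ, true_implies]
  constructor
  · intro h
    have hp : f p ≠ ⊤ := by
      intro hp
      obtain ⟨y, hy⟩ := hf.exists_ne_top
      have := h y
      rw [htop p hp, hval y hy, top_le_iff] at this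
      exact EReal.coe_ne_top _ this
    refine ⟨hp, fun y hy => ?_⟩
    have := h y
    rwa [hval p hp, hval y hy, EReal.coe_le_coe_iff] at this
  · rintro ⟨hp, h⟩ y
    by_cases hy : f y = ⊤
    · rw [htop y hy]; exact le_top
    · rw [hval p hp, hval y hy, EReal.coe_le_coe_iff]
      exact h y hy

lemma isMinOn_add_iff (hf : IsGammaZero f) (k : E → ℝ) (p : E) :
    IsMinOn (fun y => f y + (k y : EReal)) univ p ↔
      f p ≠ ⊤ ∧ ∀ y, f y ≠ ⊤ → (f p).toReal + k p ≤ (f y).toReal + k y := by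
  simpa using hf.isMinOn_mul_add_iff one_pos k p

end IsGammaZero

lemma HasGradientAt.hasDerivAt_add_smul [CompleteSpace E] {k : E → ℝ} {k' x : E}
    (hk : HasGradientAt k k' x) (v : E) :
    HasDerivAt (fun t : ℝ => k (x + t • v)) ⟪v, k'⟫ 0 := by
  have h1 : HasDerivAt (fun t : ℝ => x + t • v) v 0 := by
    simpa using ((hasDerivAt_id (0 : ℝ)).smul_const v).const_add x
  have h2 : HasFDerivAt k (InnerProductSpace.toDual ℝ E k') (x + (0 : ℝ) • v) := by
    simpa using hk.hasFDerivAt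
  have h3 := h2.comp_hasDerivAt (0 : ℝ) h1
  rw [InnerProductSpace.toDual_apply_apply, real_inner_comm] at h3
  exact h3

/-- Fermat's rule for a sum of a convex function and a differentiable function: only the
differentiable summand is linearized, the convex one is kept. -/
lemma IsGammaZero.neg_inv_smul_mem_subdifferential [CompleteSpace E] {f : E → EReal}
    (hf : IsGammaZero f) {a : ℝ} (ha : 0 < a) {k : E → ℝ} {k' p : E} (hk : HasGradientAt k k' p)
    (hp : IsMinOn (fun y => (a : EReal) * f y + (k y : EReal)) univ p) :
    -(a⁻¹ • k') ∈ subdifferential f p := by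
  rw [hf.isMinOn_mul_add_iff ha] at hp
  obtain ⟨hp, hmin⟩ := hp
  rw [hf.mem_subdifferential_iff]
  refine ⟨hp, fun y hy => ?_⟩
  have hlim := (hk.hasDerivAt_add_smul (y - p)).tendsto_slope_zero_right
  have hle : a * ((f p).toReal - (f y).toReal) ≤ ⟪y - p, k'⟫ := by
    refine ge_of_tendsto hlim ?_
    filter_upwards [Ioo_mem_nhdsGT (zero_lt_one' ℝ)] with t ht
    obtain ⟨h1, h2⟩ := hf.toReal_convex hp hy (a := 1 - t) (b := t) (by linarith [ht.2]) ht.1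
      (by ring)
    have h3 := hmin _ h1
    have h4 : (1 - t) • p + t • y = p + t • (y - p) := by module
    rw [h4] at h2 h3
    rw [zero_add, zero_smul, add_zero, smul_eq_mul, ← div_eq_inv_mul, le_div_iff₀ ht.1]
    nlinarith [mul_le_mul_of_nonneg_left h2 ha.le]
  rw [inner_neg_right, inner_smul_right]
  have : (f p).toReal - (f y).toReal ≤ a⁻¹ * ⟪y - p, k'⟫ := by
    rwa [← div_eq_inv_mul, le_div_iff₀ ha, mul_comm]
  linarith

lemma ConvexOn.add_inner_le [CompleteSpace E] {h : E → ℝ} (hc : ConvexOn ℝ univ h) {h' x : E}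
    (hx : HasGradientAt h h' x) (y : E) : h x + ⟪y - x, h'⟫ ≤ h y := by
  have hlim := (hx.hasDerivAt_add_smul (y - x)).tendsto_slope_zero_right
  have hle : ⟪y - x, h'⟫ ≤ h y - h x := by
    refine le_of_tendsto hlim ?_
    filter_upwards [Ioo_mem_nhdsGT (zero_lt_one' ℝ)] with t ht
    have h1 := hc.2 (mem_univ x) (mem_univ y) (show 0 ≤ 1 - t by linarith [ht.2]) ht.1.le
      (by ring)
    have h4 : (1 - t) • x + t • y = x + t • (y - x) := by module
    rw [h4, smul_eq_mul, smul_eq_mul] at h1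
    rw [zero_add, zero_smul, add_zero, smul_eq_mul, ← div_eq_inv_mul, div_le_iff₀ ht.1]
    linarith
  linarith

lemma ConvexOn.gradient_monotone [CompleteSpace E] {h : E → ℝ} (hc : ConvexOn ℝ univ h)
    (hd : Differentiable ℝ h) (x y : E) : 0 ≤ ⟪x - y, ∇ h x - ∇ h y⟫ := by
  have h1 := hc.add_inner_le (hd x).hasGradientAt y
  have h2 := hc.add_inner_le (hd y).hasGradientAt x
  have h3 : ⟪y - x, ∇ h x⟫ = -⟪x - y, ∇ h x⟫ := by rw [← inner_neg_left, neg_sub]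
  rw [inner_sub_right]
  linarith

lemma isMinOn_add_iff_mem_zerSum [CompleteSpace E] {f : E → EReal} (hf : IsGammaZero f)
    {h : E → ℝ} (hc : ConvexOn ℝ univ h) (hd : Differentiable ℝ h) (z : E) :
    IsMinOn (fun y => f y + (h y : EReal)) univ z ↔ z ∈ zerSum (subdifferential f) (∇ h) := by
  constructor
  · intro hz
    refine ⟨-∇ h z, ?_, by simp⟩
    simpa using hf.neg_inv_smul_mem_subdifferential one_pos (hd z).hasGradientAt
      (by simpa using hz)
  · rintro ⟨u, hu, huz⟩
    rw [hf.mem_subdifferential_iff] at hu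
    rw [hf.isMinOn_add_iff]
    refine ⟨hu.1, fun y hy => ?_⟩
    have h1 := hu.2 y hy
    have h2 := hc.add_inner_le (hd z).hasGradientAt y
    rw [eq_neg_of_add_eq_zero_left huz, inner_neg_right] at h1
    linarith

lemma hasGradientAt_norm_sub_sq_half [CompleteSpace E] (u p : E) :
    HasGradientAt (fun y => ‖u - y‖ ^ 2 / 2) (p - u) p := by
  rw [hasGradientAt_iff_hasFDerivAt]
  have h1 : HasFDerivAt (fun y : E => u - y) (-ContinuousLinearMap.id ℝ E) p :=
    (hasFDerivAt_id p).const_sub u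
  have h2 := (h1.norm_sq).mul_const (2⁻¹ : ℝ)
  refine (h2.congr_fderiv ?_).congr_of_eventuallyEq (Eventually.of_forall fun y => ?_)
  · ext v
    simp
  · simp [div_eq_mul_inv]

lemma IsProx.inv_smul_mem_subdifferential [CompleteSpace E] {f : E → EReal} (hf : IsGammaZero f)
    {γ : ℝ} (hγ : 0 < γ) {u p : E} (hp : IsProx (fun q => (γ : EReal) * f q) u p) :
    γ⁻¹ • (u - p) ∈ subdifferential f p := by
  have := hf.neg_inv_smul_mem_subdifferential hγ (hasGradientAt_norm_sub_sq_half u p) hp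
  rwa [← smul_neg, neg_sub] at this

/-- Proximal operators are nonexpansive. -/
lemma IsProx.norm_sub_le [CompleteSpace E] {f : E → EReal} (hf : IsGammaZero f)
    {γ : ℝ} (hγ : 0 < γ) {u p u' p' : E} (hp : IsProx (fun q => (γ : EReal) * f q) u p)
    (hp' : IsProx (fun q => (γ : EReal) * f q) u' p') : ‖p - p'‖ ≤ ‖u - u'‖ := by
  have h := hf.subdifferential_monotone (hp.inv_smul_mem_subdifferential hf hγ)
    (hp'.inv_smul_mem_subdifferential hf hγ)
  rw [← smul_sub, inner_smul_right] at h
  have h1 : 0 ≤ ⟪p - p', (u - u') - (p - p')⟫ := by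
    have := nonneg_of_mul_nonneg_right h (inv_pos.2 hγ)
    rwa [show (u - p) - (u' - p') = (u - u') - (p - p') by abel] at this
  rw [inner_sub_right, real_inner_self_eq_norm_sq] at h1
  have h2 := real_inner_le_norm (p - p') (u - u')
  by_contra! hlt
  have := norm_nonneg (u - u')
  nlinarith

/-- Existence of proximal points, for functions with a continuous affine minorant: a minimizing
sequence is Cauchy by strong convexity. -/
lemma IsGammaZero.exists_isProx [CompleteSpace E] {f : E → EReal} (hf : IsGammaZero f)
    {z v : E} (hz : v ∈ subdifferential f z) {γ : ℝ} (hγ : 0 < γ) (u : E) :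
    ∃ p, IsProx (fun q => (γ : EReal) * f q) u p := by
  rw [hf.mem_subdifferential_iff] at hz
  obtain ⟨hz, hzv⟩ := hz
  set F : E → ℝ := fun y => γ * (f y).toReal + ‖u - y‖ ^ 2 / 2 with hF
  set D : Set E := {y | f y ≠ ⊤} with hD
  have hbdd : BddBelow (F '' D) := by
    refine ⟨γ * (f z).toReal + γ * ⟪u - z, v⟫ - γ ^ 2 * ‖v‖ ^ 2 / 2, ?_⟩
    rintro _ ⟨y, hy, rfl⟩
    have h1 := mul_le_mul_of_nonneg_left (hzv y hy) hγ.le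
    have h2 : ⟪y - z, v⟫ = ⟪u - z, v⟫ - ⟪u - y, v⟫ := by rw [← inner_sub_left]; congr 1; abel
    have h3 := real_inner_le_norm (u - y) v
    simp only [hF]
    rw [h2] at h1
    nlinarith [sq_nonneg (‖u - y‖ - γ * ‖v‖), mul_le_mul_of_nonneg_left h3 hγ.le]
  set m := sInf (F '' D) with hm
  have hmle : ∀ y ∈ D, m ≤ F y := fun y hy => csInf_le hbdd ⟨y, hy, rfl⟩
  have hex : ∀ n : ℕ, ∃ y ∈ D, F y < m + 1 / ((n : ℝ) + 1) := by
    intro n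
    obtain ⟨_, ⟨y, hy, rfl⟩, hlt⟩ :=
      exists_lt_of_csInf_lt (s := F '' D) ⟨_, ⟨z, hz, rfl⟩⟩
        (show m < m + 1 / ((n : ℝ) + 1) by linarith [Nat.one_div_pos_of_nat (α := ℝ) (n := n)])
    exact ⟨y, hy, hlt⟩
  choose y hyD hy using hex
  have hmid : ∀ a ∈ D, ∀ b ∈ D, ‖a - b‖ ^ 2 ≤ 4 * (F a + F b - 2 * m) := by
    intro a ha b hb
    obtain ⟨h1, h2⟩ := hf.toReal_convex ha hb (a := 1 / 2) (b := 1 / 2) (by norm_num)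
      (by norm_num) (by norm_num)
    have h3 := hmle _ h1
    have h4 := parallelogram_law_with_norm ℝ (u - a) (u - b)
    have h5 : (u - a) + (u - b) = (2 : ℝ) • (u - ((1 / 2 : ℝ) • a + (1 / 2 : ℝ) • b)) := by
      module
    have h6 : (u - a) - (u - b) = -(a - b) := by abel
    rw [h5, h6, norm_neg, norm_smul] at h4
    norm_num at h4
    simp only [hF] at h3 ⊢
    have h7 := mul_le_mul_of_nonneg_left h2 hγ.le
    norm_num at h7 h3
    nlinarith
  have hcauchy : CauchySeq y := by
    have hb : Tendsto (fun n : ℕ => √(8 * (1 / ((n : ℝ) + 1)))) atTop (𝓝 0) := by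
      have : Tendsto (fun n : ℕ => 8 * (1 / ((n : ℝ) + 1))) atTop (𝓝 0) := by
        simpa using (tendsto_one_div_add_atTop_nhds_zero_nat (𝕜 := ℝ)).const_mul 8
      have h0 := (Real.continuous_sqrt.tendsto 0).comp this
      rwa [Real.sqrt_zero] at h0
    refine cauchySeq_of_le_tendsto_0 _ (fun n k N hn hk => ?_) hb
    rw [dist_eq_norm]
    refine Real.le_sqrt_of_sq_le ((hmid _ (hyD n) _ (hyD k)).trans ?_)
    have hn' : 1 / ((n : ℝ) + 1) ≤ 1 / ((N : ℝ) + 1) := Nat.one_div_le_one_div hn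
    have hk' : 1 / ((k : ℝ) + 1) ≤ 1 / ((N : ℝ) + 1) := Nat.one_div_le_one_div hk
    linarith [hy n, hy k]
  obtain ⟨p, hp⟩ := cauchySeq_tendsto_of_complete hcauchy
  have hFy : Tendsto (fun n => F (y n)) atTop (𝓝 m) := by
    refine tendsto_of_tendsto_of_tendsto_of_le_of_le tendsto_const_nhds
      (h := fun n : ℕ => m + 1 / ((n : ℝ) + 1)) ?_ (fun n => hmle _ (hyD n)) (fun n => (hy n).le)
    simpa using (tendsto_one_div_add_atTop_nhds_zero_nat (𝕜 := ℝ)).const_add m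
  have hfy : Tendsto (fun n => (f (y n)).toReal) atTop (𝓝 ((m - ‖u - p‖ ^ 2 / 2) / γ)) := by
    have h1 : Tendsto (fun n => (F (y n) - ‖u - y n‖ ^ 2 / 2) / γ) atTop
        (𝓝 ((m - ‖u - p‖ ^ 2 / 2) / γ)) :=
      (hFy.sub (((tendsto_const_nhds.sub hp).norm.pow 2).div_const 2)).div_const γ
    refine h1.congr fun n => ?_
    simp only [hF]
    field_simp
    ring
  have hfp : ∀ t : ℝ, (m - ‖u - p‖ ^ 2 / 2) / γ < t → f p ≤ (t : EReal) := by
    intro t ht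
    refine (hf.lsc.isClosed_preimage (t : EReal)).mem_of_tendsto hp ?_
    filter_upwards [hfy.eventually_lt_const ht] with n hn
    exact hf.le_coe_iff.2 ⟨hyD n, hn.le⟩
  have hpD : f p ≠ ⊤ := (hf.le_coe_iff.1 (hfp _ (lt_add_one _))).1
  have hpm : (f p).toReal ≤ (m - ‖u - p‖ ^ 2 / 2) / γ :=
    le_of_forall_gt_imp_ge_of_dense fun t ht => (hf.le_coe_iff.1 (hfp t ht)).2
  refine ⟨p, (hf.isMinOn_mul_add_iff hγ _ p).2 ⟨hpD, fun q hq => ?_⟩⟩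
  have h1 := hmle q hq
  rw [le_div_iff₀ hγ] at hpm
  simp only [hF] at h1
  linarith

/-- The proximal operator of `γ f`, with an arbitrary value at points that have no proximal
point. -/
noncomputable def proxMap (f : E → EReal) (γ : ℝ) (u : E) : E :=
  Classical.epsilon (IsProx (fun q => (γ : EReal) * f q) u)

lemma isProx_proxMap [CompleteSpace E] {f : E → EReal} (hf : IsGammaZero f)
    {z v : E} (hz : v ∈ subdifferential f z) {γ : ℝ} (hγ : 0 < γ) (u : E) :
    IsProx (fun q => (γ : EReal) * f q) u (proxMap f γ u) :=
  Classical.epsilon_spec (hf.exists_isProx hz hγ u)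

lemma lipschitzWith_proxMap [CompleteSpace E] {f : E → EReal} (hf : IsGammaZero f)
    {z v : E} (hz : v ∈ subdifferential f z) {γ : ℝ} (hγ : 0 < γ) :
    LipschitzWith 1 (proxMap f γ) :=
  LipschitzWith.of_dist_le' (K := 1) (fun a b => by
    rw [dist_eq_norm, dist_eq_norm, one_mul]
    exact (isProx_proxMap hf hz hγ a).norm_sub_le hf hγ (isProx_proxMap hf hz hγ b))
    |>.weaken (by simp)

lemma IsProx.eq_proxMap [CompleteSpace E] {f : E → EReal} (hf : IsGammaZero f)
    {z v : E} (hz : v ∈ subdifferential f z) {γ : ℝ} (hγ : 0 < γ) {u p : E}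
    (hp : IsProx (fun q => (γ : EReal) * f q) u p) : p = proxMap f γ u := by
  have h := hp.norm_sub_le hf hγ (isProx_proxMap hf hz hγ u)
  rw [sub_self, norm_zero] at h
  exact sub_eq_zero.1 (norm_le_zero_iff.1 h)

end ConvexAnalysis

/-! ### Weak convergence in Hilbert spaces -/

/-- If the distances to every point of a dense subset converge, then so do the distances to every
point. -/
lemma exists_tendsto_norm_sub_of_subset_closure {E : Type*} [SeminormedAddCommGroup E]
    {Z Z₀ : Set E} (hZ : Z ⊆ closure Z₀) {x : ℕ → E}
    (hlim : ∀ z ∈ Z₀, ∃ r, Tendsto (fun n => ‖x n - z‖) atTop (𝓝 r)) :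
    ∀ z ∈ Z, ∃ r, Tendsto (fun n => ‖x n - z‖) atTop (𝓝 r) := by
  intro z hz
  refine cauchySeq_tendsto_of_complete (Metric.cauchySeq_iff'.2 fun ε hε => ?_)
  obtain ⟨w, hw, hzw⟩ := Metric.mem_closure_iff.1 (hZ hz) (ε / 3) (by positivity)
  obtain ⟨r, hr⟩ := hlim w hw
  obtain ⟨N, hN⟩ := Metric.cauchySeq_iff'.1 hr.cauchySeq (ε / 3) (by positivity)
  refine ⟨N, fun n hn => ?_⟩
  have h1 := hN n hn
  rw [Real.dist_eq] at h1 ⊢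
  have h2 : ∀ k, |‖x k - z‖ - ‖x k - w‖| ≤ dist z w := fun k => by
    refine (abs_norm_sub_norm_le _ _).trans ?_
    rw [dist_comm, dist_eq_norm]
    apply le_of_eq
    congr 1
    abel
  have h3 := abs_le.1 (h2 n)
  have h4 := abs_le.1 (h2 N)
  have h5 := abs_lt.1 h1
  rw [abs_lt]
  constructor <;> linarith

section WeakConvergence

variable {E : Type*} [NormedAddCommGroup E] [InnerProductSpace ℝ E] [CompleteSpace E]

lemma inner_toDual_symm_right (x : E) (φ : StrongDual ℝ E) :
    ⟪x, (InnerProductSpace.toDual ℝ E).symm φ⟫ = φ x := by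
  rw [real_inner_comm, InnerProductSpace.toDual_symm_apply]

/-- Weak compactness of bounded sets, phrased with ultrafilters: a bounded family has a weak limit
along every ultrafilter. -/
lemma Ultrafilter.exists_tendsto_inner {ι : Type*} (l : Ultrafilter ι) {x : ι → E} {R : ℝ}
    (hx : ∀ i, ‖x i‖ ≤ R) : ∃ p : E, ∀ v, Tendsto (fun i => ⟪x i, v⟫) l (𝓝 ⟪p, v⟫) := by
  let X : ι → WeakDual ℝ E := fun i => StrongDual.toWeakDual (InnerProductSpace.toDual ℝ E (x i))
  obtain ⟨φ, -, hφ⟩ := (WeakDual.isCompact_closedBall (𝕜 := ℝ) (E := E) 0 R).ultrafilter_le_nhds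
    (l.map X) (le_principal_iff.2 (mem_map.2 (univ_mem' fun i => by simpa [X] using hx i)))
  refine ⟨(InnerProductSpace.toDual ℝ E).symm (WeakDual.toStrongDual φ), fun v => ?_⟩
  have h1 := (WeakDual.eval_continuous v).tendsto φ
  have h2 : Tendsto X l (𝓝 φ) := hφ
  have h3 := h1.comp h2
  rw [InnerProductSpace.toDual_symm_apply]
  exact h3

lemma tendsto_toWeakSpace_iff {ι : Type*} {l : Filter ι} {x : ι → E} {p : E} :
    Tendsto (fun i => toWeakSpace ℝ E (x i)) l (𝓝 (toWeakSpace ℝ E p)) ↔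
      ∀ v, Tendsto (fun i => ⟪x i, v⟫) l (𝓝 ⟪p, v⟫) := by
  constructor
  · intro h v
    have h1 := (WeakBilin.eval_continuous (topDualPairing ℝ E).flip
      (InnerProductSpace.toDual ℝ E v)).tendsto (toWeakSpace ℝ E p)
    have h2 := h1.comp h
    simp only [real_inner_comm v]
    exact h2
  · intro h
    refine (WeakBilin.tendsto_iff_forall_eval_tendsto (topDualPairing ℝ E).flip ?_).2 ?_
    rotate_left
    · intro φ
      have h1 := h ((InnerProductSpace.toDual ℝ E).symm φ)
      simp only [inner_toDual_symm_right] at h1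
      exact h1
    · intro a b hab
      refine ext_inner_left ℝ fun v => ?_
      exact DFunLike.congr_fun hab (InnerProductSpace.toDual ℝ E v)

lemma Convex.mem_of_tendsto_inner {C : Set E} (hC : Convex ℝ C) (hC' : IsClosed C) {ι : Type*}
    {l : Filter ι} [NeBot l] {x : ι → E} {p : E}
    (hx : ∀ v, Tendsto (fun i => ⟪x i, v⟫) l (𝓝 ⟪p, v⟫)) (hmem : ∀ᶠ i in l, x i ∈ C) : p ∈ C := by
  by_contra hp
  obtain ⟨φ, s, hs, hsp⟩ := geometric_hahn_banach_closed_point hC hC' hp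
  have h : Tendsto (fun i => φ (x i)) l (𝓝 (φ p)) := by
    simpa only [inner_toDual_symm_right] using
      hx ((InnerProductSpace.toDual ℝ E).symm φ)
  exact hsp.not_ge (le_of_tendsto h (hmem.mono fun i hi => (hs _ hi).le))

/-- The graph of `∂f + ∇h` is closed along bounded families that converge weakly in the domain and
to `0` in norm in the range. -/
lemma mem_zerSum_of_tendsto {f : E → EReal} (hf : IsGammaZero f)
    {h : E → ℝ} (hc : ConvexOn ℝ univ h) (hd : Differentiable ℝ h) {ι : Type*}
    {l : Filter ι} [NeBot l] {x v : ι → E} {p : E} {R : ℝ} (hR : ∀ i, ‖x i‖ ≤ R)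
    (hx : ∀ a, Tendsto (fun i => ⟪x i, a⟫) l (𝓝 ⟪p, a⟫))
    (hv : ∀ᶠ i in l, v i ∈ subdifferential f (x i))
    (hv0 : Tendsto (fun i => v i + ∇ h (x i)) l (𝓝 0)) :
    p ∈ zerSum (subdifferential f) (∇ h) := by
  rw [← isMinOn_add_iff_mem_zerSum hf hc hd, hf.isMinOn_add_iff]
  have key : ∀ y, f y ≠ ⊤ → ∀ t : ℝ, (f y).toReal + h y - h p < t → f p ≤ (t : EReal) := by
    intro y hy t ht
    -- sublevel sets of `f` are convex and closed, hence weakly closed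
    have hconv : Convex ℝ {q | f q ≤ (t : EReal)} := by
      intro a ha b hb r s hr hs hrs
      rcases hr.eq_or_lt with rfl | hr
      · simpa [show s = 1 by linarith] using hb
      rcases hs.eq_or_lt with rfl | hs
      · simpa [show r = 1 by linarith] using ha
      simp only [mem_ofPred_eq, hf.le_coe_iff] at ha hb ⊢
      obtain ⟨h1, h2⟩ := hf.toReal_convex ha.1 hb.1 hr hs hrs
      refine ⟨h1, h2.trans ?_⟩
      have : r * t + s * t = t := by rw [← add_mul, hrs, one_mul]
      linarith [mul_le_mul_of_nonneg_left ha.2 hr.le, mul_le_mul_of_nonneg_left hb.2 hs.le]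
    refine hconv.mem_of_tendsto_inner (hf.lsc.isClosed_preimage (t : EReal)) hx ?_
    have hsmall : Tendsto (fun i => ⟪y - x i, v i + ∇ h (x i)⟫) l (𝓝 0) := by
      refine squeeze_zero_norm (a := fun i => (‖y‖ + R) * ‖v i + ∇ h (x i)‖) (fun i => ?_) ?_
      · refine (norm_inner_le_norm _ _).trans ?_
        gcongr
        exact (norm_sub_le _ _).trans (by linarith [hR i])
      · simpa using hv0.norm.const_mul (‖y‖ + R)
    have hlin : Tendsto (fun i => ⟪x i - p, ∇ h p⟫) l (𝓝 0) := by
      have := (hx (∇ h p)).sub_const ⟪p, ∇ h p⟫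
      simpa [inner_sub_left] using this
    have hlim : Tendsto (fun i => (f y).toReal + h y - h p - ⟪x i - p, ∇ h p⟫ -
        ⟪y - x i, v i + ∇ h (x i)⟫) l (𝓝 ((f y).toReal + h y - h p - 0 - 0)) :=
      (hlin.const_sub _).sub hsmall
    rw [sub_zero, sub_zero] at hlim
    filter_upwards [hlim.eventually_lt_const ht, hv] with i hi hvi
    rw [hf.mem_subdifferential_iff] at hvi
    refine hf.le_coe_iff.2 ⟨hvi.1, ?_⟩
    have h1 := hvi.2 y hy
    have h2 := hc.add_inner_le (hd (x i)).hasGradientAt y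
    have h3 := hc.add_inner_le (hd p).hasGradientAt (x i)
    rw [inner_add_right] at hi
    linarith
  obtain ⟨y₀, hy₀⟩ := hf.exists_ne_top
  refine ⟨(hf.le_coe_iff.1 (key y₀ hy₀ _ (lt_add_one _))).1, fun y hy => ?_⟩
  have : (f p).toReal ≤ (f y).toReal + h y - h p :=
    le_of_forall_gt_imp_ge_of_dense fun t ht => (hf.le_coe_iff.1 (key y hy t ht)).2
  linarith

/-- Opial's lemma. -/
lemma exists_tendsto_inner_of_opial {Z : Set E} (hZ : Z.Nonempty) {x : ℕ → E}
    (hlim : ∀ z ∈ Z, ∃ r, Tendsto (fun n => ‖x n - z‖) atTop (𝓝 r))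
    (hcl : ∀ (l : Ultrafilter ℕ) (p : E), (l : Filter ℕ) ≤ atTop →
      (∀ v, Tendsto (fun n => ⟪x n, v⟫) l (𝓝 ⟪p, v⟫)) → p ∈ Z) :
    ∃ p ∈ Z, ∀ v, Tendsto (fun n => ⟪x n, v⟫) atTop (𝓝 ⟪p, v⟫) := by
  obtain ⟨z, hz⟩ := hZ
  obtain ⟨r, hr⟩ := hlim z hz
  obtain ⟨R, hR⟩ := hr.bddAbove_range
  have hb : ∀ n, ‖x n‖ ≤ R + ‖z‖ := fun n => by
    have h1 : ‖x n - z‖ ≤ R := hR ⟨n, rfl⟩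
    have h2 := norm_add_le (x n - z) z
    rw [sub_add_cancel] at h2
    linarith
  have hl : ((hyperfilter ℕ : Ultrafilter ℕ) : Filter ℕ) ≤ atTop := by
    rw [← Nat.cofinite_eq_atTop]; exact hyperfilter_le_cofinite
  obtain ⟨p, hp⟩ := (hyperfilter ℕ).exists_tendsto_inner hb
  have hpZ := hcl _ p hl hp
  refine ⟨p, hpZ, fun v => ?_⟩
  rw [tendsto_iff_ultrafilter]
  intro l hle
  obtain ⟨q, hq⟩ := l.exists_tendsto_inner hb
  have hqZ := hcl l q hle hq
  suffices p = q by rw [this]; exact hq v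
  obtain ⟨r₁, hr₁⟩ := hlim p hpZ
  obtain ⟨r₂, hr₂⟩ := hlim q hqZ
  have hconv : Tendsto (fun n => ⟪x n, p - q⟫) atTop
      (𝓝 ((r₂ ^ 2 - r₁ ^ 2 + ‖p‖ ^ 2 - ‖q‖ ^ 2) / 2)) := by
    refine (((((hr₂.pow 2).sub (hr₁.pow 2)).add_const (‖p‖ ^ 2)).sub_const
      (‖q‖ ^ 2)).div_const 2).congr fun n => ?_
    rw [norm_sub_sq_real, norm_sub_sq_real, inner_sub_right]
    ring
  have e1 := tendsto_nhds_unique (hp (p - q)) (hconv.mono_left hl)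
  have e2 := tendsto_nhds_unique (hq (p - q)) (hconv.mono_left hle)
  have e3 : ⟪p - q, p - q⟫ = 0 := by rw [inner_sub_left]; linarith
  exact sub_eq_zero.1 (inner_self_eq_zero.1 e3)

end WeakConvergence

/-! ### The energy of the reflected forward-backward iteration -/

section Energy

variable {E : Type*} [NormedAddCommGroup E] [InnerProductSpace ℝ E]

/-- The Lyapunov function of the reflected forward-backward method, relative to a point `z`:
`a` and `b` are consecutive iterates, and `y` is the reflected point at which the operator `B` was
evaluated to produce `b`. The inner product is what is left over from the telescoping of the
forward steps, and the last two terms dominate it. -/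
noncomputable def reflectedEnergy (α β M : ℝ) (B : E → E) (z a b y : E) : ℝ :=
  α * ‖b - z‖ ^ 2 + 2 * ⟪b - a, B y - B z⟫ + β * ‖b - a‖ ^ 2 + M * ‖b - y‖ ^ 2

/-- Young's inequality with the weights that make the coefficient `√2` of `s ^ 2`, increased by the
`1` that is the coefficient of `c ^ 2`, equal to the coefficient of `b ^ 2`. This balance is the
origin of the step size restriction `γ M < √2 - 1 = (1 + √2)⁻¹`. -/
lemma two_mul_mul_add_le (s b c : ℝ) :
    2 * s * (b + c) ≤ √2 * s ^ 2 + (1 + √2) * b ^ 2 + c ^ 2 := by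
  have h2 : √2 * √2 = 2 := Real.mul_self_sqrt (by norm_num)
  have h0 := Real.sqrt_nonneg 2
  have h : √2 * s ^ 2 + (1 + √2) * b ^ 2 + c ^ 2 - 2 * s * (b + c) =
      √2 * (s - √2 / 2 * (b + c)) ^ 2 + √2 / 2 * (1 + √2) * (b - (√2 - 1) * c) ^ 2 := by
    linear_combination (s * (b + c) - (1 / 2 + √2 / 4) * b ^ 2 + √2 / 2 * b * c
      + (√2 / 4 - √2 ^ 2 / 2 - 1 / 2) * c ^ 2) * h2
  have : 0 ≤ √2 * (s - √2 / 2 * (b + c)) ^ 2 +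
    √2 / 2 * (1 + √2) * (b - (√2 - 1) * c) ^ 2 := by positivity
  linarith

lemma half_mul_norm_sq_le_reflectedEnergy {α β M : ℝ} {B : E → E} (hM : 0 ≤ M)
    (hB : ∀ x y, ‖B x - B y‖ ≤ M * ‖x - y‖) (hα : M * (1 + √2) ≤ α) (hβ : M * (1 + √2) ≤ β)
    (z a b y : E) : α / 2 * ‖b - z‖ ^ 2 ≤ reflectedEnergy α β M B z a b y := by
  have h1 : -⟪b - a, B y - B z⟫ ≤ ‖b - a‖ * (M * (‖b - z‖ + ‖b - y‖)) := by
    refine (neg_le_abs _).trans ((abs_real_inner_le_norm _ _).trans ?_)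
    gcongr
    refine (hB y z).trans ?_
    gcongr
    have := norm_sub_le (b - z) (b - y)
    rwa [show b - z - (b - y) = y - z by abel] at this
  have h2 : √2 * √2 = 2 := Real.mul_self_sqrt (by norm_num)
  have h0 := Real.sqrt_nonneg 2
  have h3 : 2 * ‖b - a‖ * (‖b - z‖ + ‖b - y‖) ≤
      (1 + √2) * ‖b - a‖ ^ 2 + √2 / 2 * ‖b - z‖ ^ 2 + ‖b - y‖ ^ 2 := by
    have e : (1 + √2) * ‖b - a‖ ^ 2 + √2 / 2 * ‖b - z‖ ^ 2 + ‖b - y‖ ^ 2 -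
        2 * ‖b - a‖ * (‖b - z‖ + ‖b - y‖) =
        (‖b - a‖ - ‖b - y‖) ^ 2 + √2 * (‖b - a‖ - √2 / 2 * ‖b - z‖) ^ 2 := by
      linear_combination (‖b - a‖ * ‖b - z‖ - √2 / 4 * ‖b - z‖ ^ 2) * h2
    have : 0 ≤ (‖b - a‖ - ‖b - y‖) ^ 2 + √2 * (‖b - a‖ - √2 / 2 * ‖b - z‖) ^ 2 := by positivity
    linarith
  have h4 := mul_le_mul_of_nonneg_left h3 hM
  have h5 := mul_le_mul_of_nonneg_right hβ (sq_nonneg ‖b - a‖)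
  have h6 := mul_le_mul_of_nonneg_right (show M * √2 ≤ α by linarith) (sq_nonneg ‖b - z‖)
  unfold reflectedEnergy
  linarith

/-- The estimate behind `reflectedEnergy_succ_le`, in terms of the increments `p = c - b`,
`q = b - a`, `w = b - z` and of the differences `G = B y - B z`, `G' = B y' - B z`. -/
lemma energy_increment_le {α α' M κ : ℝ} {p q w G G' e e' : E} (hM : 0 ≤ M)
    (hα : M * (1 + √2) ≤ α) (hα' : α' ≤ α)
    (hcz : 0 ≤ ⟪w + p, -(α' • p) - G' - e'⟫)
    (hcb : 0 ≤ ⟪p, -(α' • p) - G' - e' + α • q + G + e⟫)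
    (hm : 0 ≤ ⟪w + q, G'⟫) (hL : ‖G' - G‖ ≤ M * (‖q‖ + κ)) :
    α' * ‖w + p‖ ^ 2 + 2 * ⟪p, G'⟫ + (α' + M * (1 + √2)) * ‖p‖ ^ 2 + M * ‖p - q‖ ^ 2 +
        (2 * α' - α - M * (1 + √2)) * ‖p‖ ^ 2 ≤
      α * ‖w‖ ^ 2 + 2 * ⟪q, G⟫ + (α + M * (1 + √2)) * ‖q‖ ^ 2 + M * κ ^ 2 -
        2 * ⟪w + p, e'⟫ - 2 * ⟪p, e' - e⟫ := by
  have hi : ⟪q - p, G' - G⟫ ≤ ‖p - q‖ * (M * (‖q‖ + κ)) := by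
    refine (real_inner_le_norm _ _).trans ?_
    rw [norm_sub_rev q p]
    gcongr
  have hs := mul_le_mul_of_nonneg_left (two_mul_mul_add_le ‖p - q‖ ‖q‖ κ) hM
  have h5 := mul_le_mul_of_nonneg_right hα (sq_nonneg ‖p - q‖)
  have h6 := mul_le_mul_of_nonneg_right hα' (sq_nonneg ‖w‖)
  have n1 := norm_add_sq_real w p
  have n2 := norm_sub_sq_real p q
  simp only [inner_add_left, inner_add_right, inner_sub_left, inner_sub_right, inner_neg_right,
    inner_smul_right, real_inner_self_eq_norm_sq] at *
  rw [n1]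
  rw [n2] at hs h5 ⊢
  linarith

/-- The estimate behind `reflectedEnergy_succ_le_of_stronglyMonotone`, in the notation of
`energy_increment_le`. -/
lemma energy_increment_le_of_stronglyMonotone {α ν M κ : ℝ} {p q w G G' e' : E} (hM : 0 ≤ M)
    (hα : 7 * M ≤ α) (hcz : ν * ‖w + p‖ ^ 2 ≤ ⟪w + p, -(α • p) - G' - e'⟫)
    (hm : 0 ≤ ⟪w + q, G'⟫) (hL : ‖G' - G‖ ≤ M * (‖q‖ + κ)) :
    (α + 2 * ν) * ‖w + p‖ ^ 2 + 2 * ⟪p, G'⟫ + 5 * M * ‖p‖ ^ 2 + M * ‖p - q‖ ^ 2 ≤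
      α * ‖w‖ ^ 2 + 2 * ⟪q, G⟫ + 5 * M * ‖q‖ ^ 2 + M * κ ^ 2 - 2 * ⟪w + p, e'⟫ := by
  have hi : ⟪q, G' - G⟫ ≤ ‖q‖ * (M * (‖q‖ + κ)) := by
    refine (real_inner_le_norm _ _).trans ?_
    gcongr
  have hs : M * (2 * ‖q‖ * (‖q‖ + κ)) ≤ M * (3 * ‖q‖ ^ 2 + κ ^ 2) := by
    gcongr
    nlinarith [sq_nonneg (‖q‖ - κ)]
  have hpq : M * ‖p - q‖ ^ 2 ≤ M * (2 * ‖p‖ ^ 2 + 2 * ‖q‖ ^ 2) := by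
    gcongr
    have h1 := parallelogram_law_with_norm ℝ p q
    nlinarith [sq_nonneg ‖p + q‖]
  have h5 := mul_le_mul_of_nonneg_right hα (sq_nonneg ‖p‖)
  have n1 := norm_add_sq_real w p
  simp only [inner_add_left, inner_sub_right, inner_neg_right, inner_smul_right,
    real_inner_self_eq_norm_sq] at *
  rw [n1] at hcz ⊢
  linarith

/-- One step of the reflected forward-backward method: `e` and `e'` are the errors in the two
forward steps that produce `b` and `c`. -/
lemma reflectedEnergy_succ_le {α α' M : ℝ} {B : E → E} {a b c y y' z e e' : E} (hM : 0 ≤ M)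
    (hB : ∀ x y, ‖B x - B y‖ ≤ M * ‖x - y‖) (hBmono : ∀ x y, 0 ≤ ⟪x - y, B x - B y⟫)
    (hα : M * (1 + √2) ≤ α) (hα' : α' ≤ α) (hy' : y' = (2 : ℝ) • b - a)
    (hcz : 0 ≤ ⟪c - z, α' • (b - c) - B y' - e' + B z⟫)
    (hcb : 0 ≤ ⟪c - b, (α' • (b - c) - B y' - e') - (α • (a - b) - B y - e)⟫) :
    reflectedEnergy α' (α' + M * (1 + √2)) M B z b c y' +
        (2 * α' - α - M * (1 + √2)) * ‖c - b‖ ^ 2 ≤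
      reflectedEnergy α (α + M * (1 + √2)) M B z a b y -
        2 * ⟪c - z, e'⟫ - 2 * ⟪c - b, e' - e⟫ := by
  have hm := hBmono y' z
  have hL : ‖(B y' - B z) - (B y - B z)‖ ≤ M * (‖b - a‖ + ‖b - y‖) := by
    rw [sub_sub_sub_cancel_right]
    refine (hB _ y).trans ?_
    gcongr
    have := norm_add_le (b - a) (b - y)
    rwa [show b - a + (b - y) = y' - y by rw [hy']; module] at this
  have v1 : c - z = (b - z) + (c - b) := by abel
  have v2 : c - y' = (c - b) - (b - a) := by rw [hy']; module
  rw [v1, show α' • (b - c) - B y' - e' + B z = -(α' • (c - b)) - (B y' - B z) - e' by module]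
    at hcz
  rw [show (α' • (b - c) - B y' - e') - (α • (a - b) - B y - e) =
    -(α' • (c - b)) - (B y' - B z) - e' + α • (b - a) + (B y - B z) + e by module] at hcb
  rw [show y' - z = (b - z) + (b - a) by rw [hy']; module] at hm
  unfold reflectedEnergy
  rw [v1, v2]
  exact energy_increment_le hM hα hα' hcz hcb hm hL

/-- One step of the reflected forward-backward method in the strongly monotone case. As the weight
`α` tends to infinity, crude constants suffice, and monotonicity at consecutive iterates is not
needed. -/
lemma reflectedEnergy_succ_le_of_stronglyMonotone {α ν M : ℝ} {B : E → E} {a b c y y' z e' : E}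
    (hM : 0 ≤ M) (hB : ∀ x y, ‖B x - B y‖ ≤ M * ‖x - y‖)
    (hBmono : ∀ x y, 0 ≤ ⟪x - y, B x - B y⟫) (hα : 7 * M ≤ α) (hy' : y' = (2 : ℝ) • b - a)
    (hcz : ν * ‖c - z‖ ^ 2 ≤ ⟪c - z, α • (b - c) - B y' - e' + B z⟫) :
    reflectedEnergy (α + 2 * ν) (5 * M) M B z b c y' ≤
      reflectedEnergy α (5 * M) M B z a b y - 2 * ⟪c - z, e'⟫ := by
  have hm := hBmono y' z
  have hL : ‖(B y' - B z) - (B y - B z)‖ ≤ M * (‖b - a‖ + ‖b - y‖) := by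
    rw [sub_sub_sub_cancel_right]
    refine (hB _ y).trans ?_
    gcongr
    have := norm_add_le (b - a) (b - y)
    rwa [show b - a + (b - y) = y' - y by rw [hy']; module] at this
  have v1 : c - z = (b - z) + (c - b) := by abel
  have v2 : c - y' = (c - b) - (b - a) := by rw [hy']; module
  rw [v1, show α • (b - c) - B y' - e' + B z = -(α • (c - b)) - (B y' - B z) - e' by module]
    at hcz
  rw [show y' - z = (b - z) + (b - a) by rw [hy']; module] at hm
  unfold reflectedEnergy
  rw [v1, v2]
  exact energy_increment_le_of_stronglyMonotone hM hα hcz hm hL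

end Energy

/-! ### Almost supermartingales -/

/-- The Robbins–Siegmund convergence theorem for a process that is killed outside a decreasing
sequence of events `A n`. Since the process is nonnegative, killing preserves the supermartingale
inequality, so that integrability is needed only on the events `A n`. -/
lemma ae_tendsto_and_summable_of_almost_supermartingale {Ω : Type*} {mΩ : MeasurableSpace Ω}
    {P : Measure Ω} [IsFiniteMeasure P] {ℱ : Filtration ℕ mΩ} {A : ℕ → Set Ω} (hA : Antitone A)
    (hAm : ∀ n, MeasurableSet[ℱ n] (A n)) {U D v : ℕ → Ω → ℝ}
    (hU : ∀ n, StronglyMeasurable[ℱ n] (U n)) (hD : ∀ n, StronglyMeasurable[ℱ (n + 1)] (D n))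
    (hv : ∀ n, StronglyMeasurable[ℱ n] (v n))
    (hU0 : ∀ n ω, 0 ≤ U n ω) (hD0 : ∀ n ω, 0 ≤ D n ω) (hv0 : ∀ n ω, 0 ≤ v n ω)
    (hUi : ∀ n, IntegrableOn (U n) (A n) P) (hUi' : ∀ n, IntegrableOn (U (n + 1)) (A n) P)
    (hDi : ∀ n, IntegrableOn (D n) (A n) P) (hvi : ∀ n, IntegrableOn (v n) (A n) P)
    (hstep : ∀ n s, MeasurableSet[ℱ n] s → s ⊆ A n →
      ∫ ω in s, (U (n + 1) ω + D n ω) ∂P ≤ ∫ ω in s, (U n ω + v n ω) ∂P)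
    {K : ℝ} (hK : ∀ ω N, ∑ k ∈ Finset.range N, (A k).indicator (v k) ω ≤ K) :
    ∀ᵐ ω ∂P, (∀ n, ω ∈ A n) →
      (∃ r, Tendsto (fun n => U n ω) atTop (𝓝 r)) ∧ Summable (fun n => D n ω) := by
  have hAm' : ∀ n, MeasurableSet (A n) := fun n => ℱ.le n _ (hAm n)
  set C : ℕ → Ω → ℝ := fun N ω =>
    ∑ k ∈ Finset.range N, ((A k).indicator (D k) ω - (A k).indicator (v k) ω) with hC
  set Z : ℕ → Ω → ℝ := fun N ω => (A N).indicator (U N) ω + C N ω with hZ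
  have hCi : ∀ N, Integrable (C N) P := fun N =>
    integrable_finsetSum _ fun k _ => ((integrable_indicator_iff (hAm' k)).2 (hDi k)).sub
      ((integrable_indicator_iff (hAm' k)).2 (hvi k))
  have hZi : ∀ N, Integrable (Z N) P := fun N =>
    ((integrable_indicator_iff (hAm' N)).2 (hUi N)).add (hCi N)
  have hZa : StronglyAdapted ℱ Z := by
    intro N
    refine ((hU N).indicator (hAm N)).add ?_
    refine Finset.stronglyMeasurable_fun_sum _ fun k hk => ?_
    have hkN : k + 1 ≤ N := Finset.mem_range.1 hk
    refine StronglyMeasurable.sub ?_ ?_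
    · exact (((hD k).mono (ℱ.mono hkN)).indicator (ℱ.mono (Nat.le_of_succ_le hkN) _ (hAm k)))
    · exact (((hv k).indicator (hAm k)).mono (ℱ.mono (Nat.le_of_succ_le hkN)))
  have hsuper : Supermartingale Z ℱ P := by
    refine supermartingale_of_setIntegral_succ_le hZa hZi fun N s hs => ?_
    have hs' : MeasurableSet s := ℱ.le N _ hs
    have hle : ∀ ω, Z (N + 1) ω ≤
        (A N).indicator (fun ω => U (N + 1) ω + D N ω - v N ω) ω + C N ω := by
      intro ω
      have h1 : (A (N + 1)).indicator (U (N + 1)) ω ≤ (A N).indicator (U (N + 1)) ω :=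
        indicator_le_indicator_of_subset (hA N.le_succ) (hU0 (N + 1)) ω
      have h2 : (A N).indicator (fun ω => U (N + 1) ω + D N ω - v N ω) ω =
          (A N).indicator (U (N + 1)) ω + (A N).indicator (D N) ω - (A N).indicator (v N) ω := by
        by_cases hω : ω ∈ A N <;> simp [hω]
      have h3 : C (N + 1) ω =
          C N ω + ((A N).indicator (D N) ω - (A N).indicator (v N) ω) :=
        Finset.sum_range_succ _ _
      simp only [hZ]
      rw [h2, h3]
      linarith
    have hi1 : Integrable ((A N).indicator (fun ω => U (N + 1) ω + D N ω - v N ω)) P :=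
      (integrable_indicator_iff (hAm' N)).2 (((hUi' N).add (hDi N)).sub (hvi N))
    have hi2 : Integrable ((A N).indicator (U N)) P := (integrable_indicator_iff (hAm' N)).2 (hUi N)
    have hmono : s ∩ A N ⊆ A N := inter_subset_right
    calc ∫ ω in s, Z (N + 1) ω ∂P
        ≤ ∫ ω in s, ((A N).indicator (fun ω => U (N + 1) ω + D N ω - v N ω) ω + C N ω) ∂P :=
          setIntegral_mono (hZi _).integrableOn (hi1.add (hCi N)).integrableOn hle
      _ = ∫ ω in s ∩ A N, (U (N + 1) ω + D N ω - v N ω) ∂P + ∫ ω in s, C N ω ∂P := by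
          rw [integral_add hi1.integrableOn (hCi N).integrableOn, setIntegral_indicator (hAm' N)]
      _ ≤ ∫ ω in s ∩ A N, U N ω ∂P + ∫ ω in s, C N ω ∂P := by
          have h1 := hstep N (s ∩ A N) (hs.inter (hAm N)) hmono
          have h2 : ∫ ω in s ∩ A N, (U (N + 1) ω + D N ω - v N ω) ∂P =
              ∫ ω in s ∩ A N, (U (N + 1) ω + D N ω) ∂P - ∫ ω in s ∩ A N, v N ω ∂P :=
            integral_sub (((hUi' N).add (hDi N)).mono_set hmono) ((hvi N).mono_set hmono)
          rw [integral_add ((hUi N).mono_set hmono) ((hvi N).mono_set hmono)] at h1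
          linarith
      _ = ∫ ω in s, Z N ω ∂P := by
          rw [integral_add hi2.integrableOn (hCi N).integrableOn, setIntegral_indicator (hAm' N)]
  have hZlow : ∀ N ω, -K ≤ Z N ω := by
    intro N ω
    have h1 : 0 ≤ (A N).indicator (U N) ω := indicator_nonneg (fun ω _ => hU0 N ω) ω
    have h2 : 0 ≤ ∑ k ∈ Finset.range N, (A k).indicator (D k) ω :=
      Finset.sum_nonneg fun k _ => indicator_nonneg (fun ω _ => hD0 k ω) ω
    have h3 := hK ω N
    simp only [hZ, hC, Finset.sum_sub_distrib]
    linarith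
  have hbdd : ∀ N, eLpNorm ((-Z) N) 1 P ≤
      ((∫ ω, Z 0 ω ∂P + 2 * K * P.real univ).toNNReal : ℝ≥0∞) := by
    intro N
    rw [Pi.neg_apply, eLpNorm_neg, eLpNorm_one_eq_lintegral_enorm,
      ← ofReal_integral_norm_eq_lintegral_enorm (hZi N)]
    refine ENNReal.ofReal_le_ofReal ?_
    have h1 : ∫ ω, ‖Z N ω‖ ∂P ≤ ∫ ω, (Z N ω + 2 * K) ∂P := by
      refine integral_mono (hZi N).norm ((hZi N).add (integrable_const _)) fun ω => ?_
      have := hZlow N ω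
      have hK0 : 0 ≤ K := by simpa using hK ω 0
      rw [Real.norm_eq_abs]
      exact abs_le.2 ⟨by linarith, by linarith⟩
    have h2 := hsuper.setIntegral_le (Nat.zero_le N) MeasurableSet.univ
    rw [setIntegral_univ, setIntegral_univ] at h2
    rw [integral_add (hZi N) (integrable_const _), integral_const, smul_eq_mul] at h1
    linarith
  filter_upwards [hsuper.neg.exists_ae_tendsto_of_bdd hbdd] with ω hω hmem
  obtain ⟨r, hr⟩ := hω
  have hZω : ∀ N, Z N ω = U N ω + ∑ k ∈ Finset.range N, D k ω - ∑ k ∈ Finset.range N, v k ω := by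
    intro N
    simp only [hZ, hC, indicator_of_mem (hmem _), Finset.sum_sub_distrib]
    ring
  have hvsum : Summable fun k => v k ω := by
    refine summable_of_sum_range_le (c := K) (fun k => hv0 k ω) fun N => ?_
    simpa only [indicator_of_mem (hmem _)] using hK ω N
  have hsum : Tendsto (fun N => U N ω + ∑ k ∈ Finset.range N, D k ω) atTop
      (𝓝 (-r + ∑' k, v k ω)) := by
    refine (hr.neg.add hvsum.hasSum.tendsto_sum_nat).congr fun N => ?_
    simp only [Pi.neg_apply, hZω]
    ring
  obtain ⟨R, hR⟩ := hsum.bddAbove_range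
  have hDsum : Summable fun k => D k ω := by
    refine summable_of_sum_range_le (c := R) (fun k => hD0 k ω) fun N => ?_
    have : U N ω + ∑ k ∈ Finset.range N, D k ω ≤ R := hR ⟨N, rfl⟩
    linarith [hU0 N ω]
  refine ⟨⟨_, (hsum.sub hDsum.hasSum.tendsto_sum_nat).congr fun N => ?_⟩, hDsum⟩
  ring

/-! ### The noise of the stochastic gradients -/

section Past

variable {Ω : Type*} {mΩ : MeasurableSpace Ω} {S : Type*} [MeasurableSpace S]

lemma indep_pastSigma {P : Measure Ω} {ξ : ℕ → Ω → S}
    (hξ : ∀ n, Measurable (ξ n)) (hind : iIndepFun ξ P) (n : ℕ) :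
    Indep (pastSigma ξ n) (MeasurableSpace.comap (ξ n) inferInstance) P := by
  have h := indep_iSup_of_disjoint (m := fun k => MeasurableSpace.comap (ξ k) inferInstance)
    (fun k => (hξ k).comap_le) hind.iIndep (S := {k | k < n}) (T := {n}) (by simp)
  have h1 : pastSigma ξ n = ⨆ k ∈ {k | k < n}, MeasurableSpace.comap (ξ k) inferInstance := by
    refine le_antisymm (iSup_le fun k => le_iSup₂_of_le (k : ℕ) k.2 le_rfl)
      (iSup₂_le fun k hk => le_iSup_of_le (⟨k, hk⟩ : Fin n) le_rfl)
  rw [h1]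
  simpa using h

/-- The filtration of the σ-algebras `σ(ξ 0, …, ξ (n - 1))`. -/
def pastFiltration {ξ : ℕ → Ω → S} (hξ : ∀ n, Measurable (ξ n)) : Filtration ℕ mΩ where
  seq := pastSigma ξ
  mono' _ _ hij := iSup_le fun k => le_iSup_of_le (k.castLE hij) le_rfl
  le' _ := iSup_le fun k => (hξ k).comap_le

lemma measurable_pastSigma_succ {Ω : Type*} (ξ : ℕ → Ω → S) (n : ℕ) :
    Measurable[pastSigma ξ (n + 1)] (ξ n) :=
  (comap_measurable (ξ n)).mono (le_iSup_of_le (Fin.last n) le_rfl) le_rfl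

end Past

lemma MeasureTheory.MemLp.integrable_real_inner {E Ω : Type*} [NormedAddCommGroup E]
    [InnerProductSpace ℝ E] {mΩ : MeasurableSpace Ω} {P : Measure Ω} {f g : Ω → E}
    (hf : MemLp f 2 P) (hg : MemLp g 2 P) : Integrable (fun ω => ⟪f ω, g ω⟫) P :=
  Integrable.mono' (hf.norm.integrable_mul hg.norm) (hf.1.inner hg.1)
    (Eventually.of_forall fun _ => norm_inner_le_norm _ _)

section Noise

variable {E : Type*} [NormedAddCommGroup E] [InnerProductSpace ℝ E] [CompleteSpace E]
  [SecondCountableTopology E] [MeasurableSpace E] [BorelSpace E]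
  {S : Type*} [MeasurableSpace S]

/-- The integral over an `m`-measurable event of the inner product of an `m`-measurable vector with
a noise `N y ζ`, where `y` is `m`-measurable, `ζ` is independent of `m`, and `N y` is centered
under the law of `ζ`, vanishes: integrate with respect to `ζ` first. -/
lemma setIntegral_inner_eq_zero_of_indep {Ω : Type*} {m mΩ : MeasurableSpace Ω} {P : Measure Ω}
    [IsProbabilityMeasure P] (hm : m ≤ mΩ) {ζ : Ω → S}
    (hζ : Measurable ζ) (hind : Indep m (MeasurableSpace.comap ζ inferInstance) P)
    {N : E → S → E} (hN : Measurable (Function.uncurry N))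
    (hNi : ∀ y, Integrable (N y) (P.map ζ)) (hN0 : ∀ y, ∫ t, N y t ∂(P.map ζ) = 0)
    {w y : Ω → E} (hw : Measurable[m] w) (hy : Measurable[m] y) {s : Set Ω}
    (hs : MeasurableSet[m] s) (hint : IntegrableOn (fun ω => ⟪w ω, N (y ω) (ζ ω)⟫) s P) :
    ∫ ω in s, ⟪w ω, N (y ω) (ζ ω)⟫ ∂P = 0 := by
  have hsi : ∀ ω, s.indicator (fun ω => ⟪w ω, N (y ω) (ζ ω)⟫) ω =
      ⟪s.indicator w ω, N (y ω) (ζ ω)⟫ := fun ω => by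
    by_cases hω : ω ∈ s <;> simp [hω]
  rw [← integral_indicator (hm _ hs)]
  rw [← integrable_indicator_iff (hm _ hs)] at hint
  rw [show s.indicator (fun ω => ⟪w ω, N (y ω) (ζ ω)⟫) = fun ω => ⟪s.indicator w ω, N (y ω) (ζ ω)⟫
    from funext hsi] at hint ⊢
  have hw' : Measurable[m] (s.indicator w) := Measurable.indicator hw hs
  let Z : Ω → E × E := fun ω => (s.indicator w ω, y ω)
  have hZm : Measurable[m] Z := hw'.prodMk hy
  have hZ : Measurable[mΩ] Z := hZm.mono hm le_rfl
  have hZind : IndepFun Z ζ P := by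
    rw [IndepFun_iff_Indep]
    exact indep_of_indep_of_le_left hind hZm.comap_le
  have hprod := hZind.map_prod_eq_prod_map_map hZ.aemeasurable hζ.aemeasurable
  let φ : (E × E) × S → ℝ := fun p => ⟪p.1.1, N p.1.2 p.2⟫
  have hφ : Measurable φ := by
    have h1 : Measurable fun p : (E × E) × S => N p.1.2 p.2 :=
      hN.comp ((measurable_snd.comp measurable_fst).prodMk measurable_snd)
    exact (measurable_fst.comp measurable_fst).inner h1
  have hpair : Measurable[mΩ] fun ω => (Z ω, ζ ω) := hZ.prodMk hζ
  have hφi : Integrable φ ((P.map Z).prod (P.map ζ)) := by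
    rw [← hprod]
    exact (integrable_map_measure hφ.aestronglyMeasurable hpair.aemeasurable).2 hint
  have : IsProbabilityMeasure (P.map ζ) := Measure.isProbabilityMeasure_map hζ.aemeasurable
  calc ∫ ω, ⟪s.indicator w ω, N (y ω) (ζ ω)⟫ ∂P
      = ∫ p, φ p ∂(P.map fun ω => (Z ω, ζ ω)) :=
        (integral_map hpair.aemeasurable hφ.aestronglyMeasurable).symm
    _ = ∫ q, ∫ t, φ (q, t) ∂(P.map ζ) ∂(P.map Z) := by rw [hprod, integral_prod _ hφi]
    _ = 0 := by
        have h0 : ∀ q : E × E, ∫ t, φ (q, t) ∂(P.map ζ) = 0 := fun q => by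
          simp only [φ]
          rw [integral_inner (hNi q.2), hN0, inner_zero_right]
        simp [h0]

end Noise

section Iteration

variable {E : Type*} [NormedAddCommGroup E] [InnerProductSpace ℝ E] [MeasurableSpace E]
  {Ω : Type*} {mΩ : MeasurableSpace Ω} {S : Type*} [MeasurableSpace S]

/-- The sequence `x` is produced by the stochastic reflected forward-backward method, for a
monotone Lipschitz operator `B` of which `G y (ξ n)` is an unbiased estimator at `y`. -/
structure IsReflectedIteration (P : Measure Ω) (f : E → EReal) (B : E → E) (M : ℝ≥0)
    (ξ : ℕ → Ω → S) (G : E → S → E) (γ : ℕ → ℝ) (x0 xm1 : E) (x : ℕ → Ω → E) : Prop where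
  gammaZero : IsGammaZero f
  lipschitz : LipschitzWith M B
  monotone : ∀ a b, 0 ≤ ⟪a - b, B a - B b⟫
  nonempty : (zerSum (subdifferential f) B).Nonempty
  measurable_sample : ∀ n, Measurable (ξ n)
  indep : iIndepFun ξ P
  measurable_estimator : Measurable (Function.uncurry G)
  integrable_estimator : ∀ n y, Integrable (G y) (P.map (ξ n))
  integral_estimator : ∀ n y, ∫ t, G y t ∂(P.map (ξ n)) = B y
  step_pos : ∀ n, 0 < γ n
  zero_eq : ∀ ω, x 0 ω = x0
  succ_isProx : ∀ n ω, IsProx (fun p => (γ n : EReal) * f p)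
    (x n ω - γ n • G (reflected xm1 x n ω) (ξ n ω)) (x (n + 1) ω)

/-- The error made in the `n`-th forward step by using an estimator in place of the operator. -/
def gradNoise (B : E → E) (ξ : ℕ → Ω → S) (G : E → S → E) (xm1 : E) (x : ℕ → Ω → E) (n : ℕ)
    (ω : Ω) : E :=
  G (reflected xm1 x n ω) (ξ n ω) - B (reflected xm1 x n ω)

namespace IsReflectedIteration

variable {P : Measure Ω} {f : E → EReal} {B : E → E} {M : ℝ≥0}
  {ξ : ℕ → Ω → S} {G : E → S → E} {γ : ℕ → ℝ} {x0 xm1 : E} {x : ℕ → Ω → E}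

lemma exists_mem_subdifferential (hI : IsReflectedIteration P f B M ξ G γ x0 xm1 x) :
    ∃ z u, u ∈ subdifferential f z := by
  obtain ⟨z, u, hu, -⟩ := hI.nonempty
  exact ⟨z, u, hu⟩

lemma norm_sub_le (hI : IsReflectedIteration P f B M ξ G γ x0 xm1 x) (a b : E) :
    ‖B a - B b‖ ≤ M * ‖a - b‖ := by
  simpa [dist_eq_norm] using hI.lipschitz.dist_le_mul a b

lemma pastSigma_le (hI : IsReflectedIteration P f B M ξ G γ x0 xm1 x) (n : ℕ) :
    pastSigma ξ n ≤ mΩ :=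
  (pastFiltration hI.measurable_sample).le n

lemma memLp_operator (hI : IsReflectedIteration P f B M ξ G γ x0 xm1 x) {Q : Measure Ω}
    [IsFiniteMeasure Q] {g : Ω → E} (hg : MemLp g 2 Q) : MemLp (fun ω => B (g ω)) 2 Q := by
  refine MemLp.of_le ((memLp_const ‖B 0‖).add (hg.norm.const_mul (M : ℝ)))
    (hI.lipschitz.continuous.comp_aestronglyMeasurable hg.1) (Eventually.of_forall fun ω => ?_)
  have h1 := hI.norm_sub_le (g ω) 0
  rw [sub_zero] at h1
  refine le_trans ?_ (le_abs_self _)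
  have h2 := norm_add_le (B (g ω) - B 0) (B 0)
  rw [sub_add_cancel] at h2
  simp only [Pi.add_apply]
  linarith

/-- The conditional variance of the noise given the past samples, with values in `[0, ∞]`. -/
noncomputable def condVar (_ : IsReflectedIteration P f B M ξ G γ x0 xm1 x) (n : ℕ) : Ω → ℝ≥0∞ :=
  P⁻[fun ω => ‖gradNoise B ξ G xm1 x n ω‖ₑ ^ 2 | pastSigma ξ n]

lemma setLIntegral_condVar [IsFiniteMeasure P]
    (hI : IsReflectedIteration P f B M ξ G γ x0 xm1 x) {n : ℕ}
    {s : Set Ω} (hs : MeasurableSet[pastSigma ξ n] s) :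
    ∫⁻ ω in s, hI.condVar n ω ∂P = ∫⁻ ω in s, ‖gradNoise B ξ G xm1 x n ω‖ₑ ^ 2 ∂P :=
  setLIntegral_condLExp (hI.pastSigma_le n) P _ hs

variable [CompleteSpace E]

lemma mem_subdifferential (hI : IsReflectedIteration P f B M ξ G γ x0 xm1 x) (n : ℕ) (ω : Ω) :
    (γ n)⁻¹ • (x n ω - x (n + 1) ω) - B (reflected xm1 x n ω) - gradNoise B ξ G xm1 x n ω ∈
      subdifferential f (x (n + 1) ω) := by
  have h := (hI.succ_isProx n ω).inv_smul_mem_subdifferential hI.gammaZero (hI.step_pos n)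
  have h1 : (γ n)⁻¹ • (γ n • G (reflected xm1 x n ω) (ξ n ω)) = G (reflected xm1 x n ω) (ξ n ω) :=
    inv_smul_smul₀ (hI.step_pos n).ne' _
  rw [sub_right_comm, smul_sub, h1] at h
  rwa [sub_sub, gradNoise, add_sub_cancel]

lemma lipschitzWith_prox (hI : IsReflectedIteration P f B M ξ G γ x0 xm1 x) (n : ℕ) :
    LipschitzWith 1 (proxMap f (γ n)) := by
  obtain ⟨z, u, hu⟩ := hI.exists_mem_subdifferential
  exact lipschitzWith_proxMap hI.gammaZero hu (hI.step_pos n)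

lemma succ_eq (hI : IsReflectedIteration P f B M ξ G γ x0 xm1 x) (n : ℕ) (ω : Ω) :
    x (n + 1) ω = proxMap f (γ n) (x n ω - γ n • (B (reflected xm1 x n ω) +
      gradNoise B ξ G xm1 x n ω)) := by
  obtain ⟨z, u, hu⟩ := hI.exists_mem_subdifferential
  rw [gradNoise, add_sub_cancel]
  exact (hI.succ_isProx n ω).eq_proxMap hI.gammaZero hu (hI.step_pos n)

lemma memLp_prox (hI : IsReflectedIteration P f B M ξ G γ x0 xm1 x) (n : ℕ) {Q : Measure Ω}
    [IsFiniteMeasure Q] {g : Ω → E} (hg : MemLp g 2 Q) :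
    MemLp (fun ω => proxMap f (γ n) (g ω)) 2 Q := by
  refine MemLp.of_le ((memLp_const ‖proxMap f (γ n) 0‖).add hg.norm)
    ((hI.lipschitzWith_prox n).continuous.comp_aestronglyMeasurable hg.1)
    (Eventually.of_forall fun ω => ?_)
  have h1 := (hI.lipschitzWith_prox n).dist_le_mul (g ω) 0
  rw [dist_eq_norm, dist_eq_norm, sub_zero, NNReal.coe_one, one_mul] at h1
  refine le_trans ?_ (le_abs_self _)
  have h2 := norm_add_le (proxMap f (γ n) (g ω) - proxMap f (γ n) 0) (proxMap f (γ n) 0)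
  rw [sub_add_cancel] at h2
  simp only [Pi.add_apply]
  linarith

/-- On a decreasing sequence of events on which the noise is square integrable, the iterates are
square integrable as well. -/
lemma memLp_aux [IsFiniteMeasure P]
    (hI : IsReflectedIteration P f B M ξ G γ x0 xm1 x) {A : ℕ → Set Ω}
    (hA : Antitone A) (he : ∀ n, MemLp (gradNoise B ξ G xm1 x n) 2 (P.restrict (A n))) (n : ℕ) :
    MemLp (x n) 2 (P.restrict (A n)) ∧ MemLp (reflected xm1 x n) 2 (P.restrict (A n)) ∧
      MemLp (x (n + 1)) 2 (P.restrict (A n)) := by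
  have hstep : ∀ n, MemLp (x n) 2 (P.restrict (A n)) →
      MemLp (reflected xm1 x n) 2 (P.restrict (A n)) →
      MemLp (x (n + 1)) 2 (P.restrict (A n)) := by
    intro n h1 h2
    have : x (n + 1) = fun ω => proxMap f (γ n) (x n ω - γ n • (B (reflected xm1 x n ω) +
      gradNoise B ξ G xm1 x n ω)) := funext (hI.succ_eq n)
    rw [this]
    exact hI.memLp_prox n (h1.sub (((hI.memLp_operator h2).add (he n)).const_smul (γ n)))
  induction n with
  | zero =>
    have h0 : x 0 = fun _ => x0 := funext hI.zero_eq
    have h1 : reflected xm1 x 0 = fun _ => (2 : ℝ) • x0 - xm1 := by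
      funext ω
      simp [reflected, hI.zero_eq]
    have hx : MemLp (x 0) 2 (P.restrict (A 0)) := by rw [h0]; exact memLp_const _
    have hy : MemLp (reflected xm1 x 0) 2 (P.restrict (A 0)) := by rw [h1]; exact memLp_const _
    exact ⟨hx, hy, hstep 0 hx hy⟩
  | succ n ih =>
    have hle : P.restrict (A (n + 1)) ≤ P.restrict (A n) :=
      Measure.restrict_mono (hA n.le_succ) le_rfl
    have hx := ih.2.2.mono_measure hle
    have hy : MemLp (reflected xm1 x (n + 1)) 2 (P.restrict (A (n + 1))) :=
      (hx.const_smul (2 : ℝ)).sub (ih.1.mono_measure hle)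
    exact ⟨hx, hy, hstep _ hx hy⟩

variable [SecondCountableTopology E] [BorelSpace E]

lemma measurable_aux (hI : IsReflectedIteration P f B M ξ G γ x0 xm1 x) (n : ℕ) :
    Measurable[pastSigma ξ n] (x n) ∧ Measurable[pastSigma ξ n] (reflected xm1 x n) := by
  have hmono : ∀ i j, i ≤ j → pastSigma ξ i ≤ pastSigma ξ j := fun _ _ hij =>
    (pastFiltration hI.measurable_sample).mono hij
  induction n with
  | zero =>
    have h0 : x 0 = fun _ => x0 := funext hI.zero_eq
    have h1 : reflected xm1 x 0 = fun _ => (2 : ℝ) • x0 - xm1 := by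
      funext ω
      simp [reflected, hI.zero_eq]
    rw [h0, h1]
    exact ⟨measurable_const, measurable_const⟩
  | succ n ih =>
    have hxn : Measurable[pastSigma ξ (n + 1)] (x n) := ih.1.mono (hmono _ _ n.le_succ) le_rfl
    have hyn : Measurable[pastSigma ξ (n + 1)] (reflected xm1 x n) :=
      ih.2.mono (hmono _ _ n.le_succ) le_rfl
    have hG : Measurable[pastSigma ξ (n + 1)] fun ω => G (reflected xm1 x n ω) (ξ n ω) :=
      hI.measurable_estimator.comp (hyn.prodMk (measurable_pastSigma_succ ξ n))
    have hx : Measurable[pastSigma ξ (n + 1)] (x (n + 1)) := by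
      have : x (n + 1) = fun ω =>
          proxMap f (γ n) (x n ω - γ n • G (reflected xm1 x n ω) (ξ n ω)) := by
        funext ω
        rw [hI.succ_eq, gradNoise, add_sub_cancel]
      rw [this]
      exact (hI.lipschitzWith_prox n).continuous.measurable.comp (hxn.sub (hG.const_smul (γ n)))
    exact ⟨hx, (hx.const_smul (2 : ℝ)).sub hxn⟩

lemma measurable_iterate (hI : IsReflectedIteration P f B M ξ G γ x0 xm1 x) (n : ℕ) :
    Measurable[pastSigma ξ n] (x n) :=
  (hI.measurable_aux n).1

lemma measurable_reflected (hI : IsReflectedIteration P f B M ξ G γ x0 xm1 x) (n : ℕ) :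
    Measurable[pastSigma ξ n] (reflected xm1 x n) :=
  (hI.measurable_aux n).2

lemma measurable_gradNoise (hI : IsReflectedIteration P f B M ξ G γ x0 xm1 x) (n : ℕ) :
    Measurable[pastSigma ξ (n + 1)] (gradNoise B ξ G xm1 x n) := by
  have hyn : Measurable[pastSigma ξ (n + 1)] (reflected xm1 x n) :=
    (hI.measurable_reflected n).mono ((pastFiltration hI.measurable_sample).mono n.le_succ) le_rfl
  exact (hI.measurable_estimator.comp (hyn.prodMk (measurable_pastSigma_succ ξ n))).sub
    (hI.lipschitz.continuous.measurable.comp hyn)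

lemma measurable_iterate' (hI : IsReflectedIteration P f B M ξ G γ x0 xm1 x) (n : ℕ) :
    Measurable (x n) :=
  (hI.measurable_iterate n).mono (hI.pastSigma_le n) le_rfl

lemma measurable_gradNoise' (hI : IsReflectedIteration P f B M ξ G γ x0 xm1 x) (n : ℕ) :
    Measurable (gradNoise B ξ G xm1 x n) :=
  (hI.measurable_gradNoise n).mono (hI.pastSigma_le _) le_rfl

variable [IsProbabilityMeasure P]

/-- Comparing `x (n + 1)` with the outcome of a noiseless step, which is independent of the
current sample, shows that the noise is almost uncorrelated with `x (n + 1)`. -/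
lemma neg_setIntegral_inner_le (hI : IsReflectedIteration P f B M ξ G γ x0 xm1 x) {n : ℕ}
    {s : Set Ω} (hs : MeasurableSet[pastSigma ξ n] s) {v : Ω → E} (hv : Measurable[pastSigma ξ n] v)
    (hvL : MemLp v 2 (P.restrict s)) (hx : MemLp (x n) 2 (P.restrict s))
    (hy : MemLp (reflected xm1 x n) 2 (P.restrict s))
    (he : MemLp (gradNoise B ξ G xm1 x n) 2 (P.restrict s)) :
    -∫ ω in s, ⟪x (n + 1) ω + v ω, gradNoise B ξ G xm1 x n ω⟫ ∂P ≤
      γ n * ∫ ω in s, ‖gradNoise B ξ G xm1 x n ω‖ ^ 2 ∂P := by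
  set T : Ω → E := fun ω => proxMap f (γ n) (x n ω - γ n • B (reflected xm1 x n ω)) with hT
  have hTL : MemLp T 2 (P.restrict s) :=
    hI.memLp_prox n (hx.sub ((hI.memLp_operator hy).const_smul (γ n)))
  have hTm : Measurable[pastSigma ξ n] T :=
    (hI.lipschitzWith_prox n).continuous.measurable.comp ((hI.measurable_iterate n).sub
      ((hI.lipschitz.continuous.measurable.comp (hI.measurable_reflected n)).const_smul (γ n)))
  have hxL : MemLp (x (n + 1)) 2 (P.restrict s) := by
    have : x (n + 1) = fun ω => proxMap f (γ n) (x n ω - γ n • (B (reflected xm1 x n ω) +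
      gradNoise B ξ G xm1 x n ω)) := funext (hI.succ_eq n)
    rw [this]
    exact hI.memLp_prox n (hx.sub (((hI.memLp_operator hy).add he).const_smul (γ n)))
  have hζ := hI.measurable_sample n
  have : IsProbabilityMeasure (P.map (ξ n)) := Measure.isProbabilityMeasure_map hζ.aemeasurable
  have hint : IntegrableOn (fun ω => ⟪T ω + v ω, gradNoise B ξ G xm1 x n ω⟫) s P :=
    (hTL.add hvL).integrable_real_inner he
  have hzero : ∫ ω in s, ⟪T ω + v ω, gradNoise B ξ G xm1 x n ω⟫ ∂P = 0 := by
    refine setIntegral_inner_eq_zero_of_indep (hI.pastSigma_le n) hζ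
      (indep_pastSigma hI.measurable_sample hI.indep n) (N := fun q t => G q t - B q)
      ?_ ?_ ?_ (hTm.add hv) (hI.measurable_reflected n) hs hint
    · exact hI.measurable_estimator.sub (hI.lipschitz.continuous.measurable.comp measurable_fst)
    · exact fun q => (hI.integrable_estimator n q).sub (integrable_const _)
    · intro q
      rw [integral_sub (hI.integrable_estimator n q) (integrable_const _), hI.integral_estimator]
      simp
  have hint2 : IntegrableOn (fun ω => ⟪x (n + 1) ω + v ω, gradNoise B ξ G xm1 x n ω⟫) s P :=
    (hxL.add hvL).integrable_real_inner he
  have hle : ∫ ω in s, (⟪T ω + v ω, gradNoise B ξ G xm1 x n ω⟫ -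
      ⟪x (n + 1) ω + v ω, gradNoise B ξ G xm1 x n ω⟫) ∂P ≤
      ∫ ω in s, γ n * ‖gradNoise B ξ G xm1 x n ω‖ ^ 2 ∂P := by
    refine setIntegral_mono (hint.sub hint2) ((he.integrable_norm_pow two_ne_zero).const_mul _)
      fun ω => ?_
    simp only
    rw [← inner_sub_left]
    have h1 := (hI.lipschitzWith_prox n).dist_le_mul (x n ω - γ n • B (reflected xm1 x n ω))
      (x n ω - γ n • (B (reflected xm1 x n ω) + gradNoise B ξ G xm1 x n ω))
    rw [← hI.succ_eq, dist_eq_norm, dist_eq_norm, NNReal.coe_one, one_mul, smul_add,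
      sub_sub_sub_cancel_left, add_sub_cancel_left, norm_smul, Real.norm_of_nonneg
      (hI.step_pos n).le] at h1
    refine (real_inner_le_norm _ _).trans ?_
    rw [add_sub_add_right_eq_sub, pow_two, ← mul_assoc]
    gcongr
  rw [integral_sub hint hint2, hzero, integral_const_mul] at hle
  linarith

lemma memLp_gradNoise (hI : IsReflectedIteration P f B M ξ G γ x0 xm1 x) {n : ℕ}
    {s : Set Ω} (hs : MeasurableSet[pastSigma ξ n] s) {K : ℝ≥0∞} (hK : K ≠ ∞)
    (h : ∀ᵐ ω ∂P.restrict s, hI.condVar n ω ≤ K) :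
    MemLp (gradNoise B ξ G xm1 x n) 2 (P.restrict s) := by
  refine ⟨(hI.measurable_gradNoise' n).aestronglyMeasurable, ?_⟩
  rw [eLpNorm_lt_top_iff_lintegral_rpow_enorm_lt_top two_ne_zero ENNReal.ofNat_ne_top]
  simp only [ENNReal.toReal_ofNat, ENNReal.rpow_ofNat]
  rw [← hI.setLIntegral_condVar hs]
  calc ∫⁻ ω in s, hI.condVar n ω ∂P ≤ ∫⁻ _ in s, K ∂P := lintegral_mono_ae h
    _ < ∞ := by
      rw [lintegral_const]
      exact ENNReal.mul_lt_top hK.lt_top (measure_lt_top _ _)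

lemma setIntegral_norm_gradNoise_sq (hI : IsReflectedIteration P f B M ξ G γ x0 xm1 x) {n : ℕ}
    {s : Set Ω} (hs : MeasurableSet[pastSigma ξ n] s) {K : ℝ≥0∞} (hK : K ≠ ∞)
    (h : ∀ᵐ ω ∂P.restrict s, hI.condVar n ω ≤ K) :
    ∫ ω in s, ‖gradNoise B ξ G xm1 x n ω‖ ^ 2 ∂P = ∫ ω in s, (hI.condVar n ω).toReal ∂P := by
  have hm : Measurable (hI.condVar n) := measurable_condLExp' _ _ _
  rw [integral_toReal hm.aemeasurable (h.mono fun ω hω => hω.trans_lt hK.lt_top),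
    hI.setLIntegral_condVar hs, integral_eq_lintegral_of_nonneg_ae
      (Eventually.of_forall fun ω => by positivity)
      ((hI.measurable_gradNoise' n).norm.pow_const 2).aestronglyMeasurable]
  congr 1
  refine lintegral_congr fun ω => ?_
  rw [ENNReal.ofReal_pow (norm_nonneg _), ofReal_norm]

end IsReflectedIteration

end Iteration

/-! ### Rate of convergence in the strongly monotone case -/

lemma exists_forall_one_le_of_eventually {a b : ℕ → ℝ} (hb : ∀ n, 1 ≤ n → 0 < b n) {C : ℝ} {N : ℕ}
    (h : ∀ n, N ≤ n → a n ≤ C * b n) : ∃ C, ∀ n, 1 ≤ n → a n ≤ C * b n := by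
  refine ⟨|C| + ∑ k ∈ Finset.range N, |a k / b k|, fun n hn => ?_⟩
  have hs : 0 ≤ ∑ k ∈ Finset.range N, |a k / b k| := Finset.sum_nonneg fun _ _ => abs_nonneg _
  rcases le_or_gt N n with hN | hN
  · refine (h n hN).trans (mul_le_mul_of_nonneg_right ?_ (hb n hn).le)
    linarith [le_abs_self C]
  · have h1 : |a n / b n| ≤ ∑ k ∈ Finset.range N, |a k / b k| :=
      Finset.single_le_sum (f := fun k => |a k / b k|) (fun _ _ => abs_nonneg _)
        (Finset.mem_range.2 hN)
    have h2 : a n / b n ≤ |C| + ∑ k ∈ Finset.range N, |a k / b k| := by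
      linarith [le_abs_self (a n / b n), abs_nonneg C]
    rwa [div_le_iff₀ (hb n hn)] at h2

lemma one_div_add_two_le_log_sub_log (n : ℕ) :
    1 / ((n : ℝ) + 2) ≤ Real.log ((n : ℝ) + 2) - Real.log ((n : ℝ) + 1) := by
  rw [← Real.log_div (by positivity) (by positivity)]
  refine le_trans (le_of_eq ?_) (Real.one_sub_inv_le_log_of_pos (by positivity))
  field_simp
  ring

section StronglyMonotone

variable {E : Type*} [NormedAddCommGroup E] [InnerProductSpace ℝ E]

lemma isMinOn_eq_singleton_of_isStronglyMonotone [CompleteSpace E] {f : E → EReal}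
    (hf : IsGammaZero f) {h : E → ℝ} (hc : ConvexOn ℝ univ h) (hd : Differentiable ℝ h) {ν : ℝ}
    (hν : 0 < ν) (hmono : IsStronglyMonotone ν (subdifferential f)) {z : E}
    (hz : z ∈ zerSum (subdifferential f) (∇ h)) :
    {w | IsMinOn (fun q => f q + (h q : EReal)) univ w} = {z} := by
  ext w
  rw [mem_ofPred_eq, isMinOn_add_iff_mem_zerSum hf hc hd, mem_singleton_iff]
  refine ⟨fun hw => ?_, fun hw => hw ▸ hz⟩
  obtain ⟨u, hu, hu0⟩ := hz
  obtain ⟨v, hv, hv0⟩ := hw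
  have h1 := hmono w z v hv u hu
  have h2 := hc.gradient_monotone hd w z
  rw [eq_neg_of_add_eq_zero_left hu0, eq_neg_of_add_eq_zero_left hv0,
    show -∇ h w - -∇ h z = -(∇ h w - ∇ h z) by abel, inner_neg_right] at h1
  have h3 : ‖w - z‖ ^ 2 ≤ 0 := by
    by_contra! h3
    nlinarith [mul_pos hν h3]
  exact sub_eq_zero.1 (norm_eq_zero.1 (pow_eq_zero_iff two_ne_zero |>.1
    (le_antisymm h3 (sq_nonneg _))))

namespace IsReflectedIteration

variable [MeasurableSpace E]
  {Ω : Type*} {mΩ : MeasurableSpace Ω} {S : Type*} [MeasurableSpace S]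
  {P : Measure Ω} {f : E → EReal} {B : E → E} {M : ℝ≥0}
  {ξ : ℕ → Ω → S} {G : E → S → E} {γ : ℕ → ℝ} {x0 xm1 : E} {x : ℕ → Ω → E}

lemma integrable_reflectedEnergy (hI : IsReflectedIteration P f B M ξ G γ x0 xm1 x)
    {Q : Measure Ω} [IsFiniteMeasure Q] {a b y : Ω → E} (ha : MemLp a 2 Q) (hb : MemLp b 2 Q)
    (hy : MemLp y 2 Q) (α β K : ℝ) (z : E) :
    Integrable (fun ω => reflectedEnergy α β K B z (a ω) (b ω) (y ω)) Q := by
  have hz : MemLp (fun _ : Ω => z) 2 Q := memLp_const z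
  have hBz : MemLp (fun _ : Ω => B z) 2 Q := memLp_const _
  exact (((((hb.sub hz).integrable_norm_pow two_ne_zero).const_mul α).add
    (((hb.sub ha).integrable_real_inner ((hI.memLp_operator hy).sub hBz)).const_mul 2)).add
    (((hb.sub ha).integrable_norm_pow two_ne_zero).const_mul β)).add
    (((hb.sub hy).integrable_norm_pow two_ne_zero).const_mul K)

variable [CompleteSpace E] [SecondCountableTopology E] [BorelSpace E] [IsProbabilityMeasure P]

/-- The mean-square distance to a zero decreases like `log n / n` if the step sizes are
`1 / (2 ν (n + 1))`. -/
lemma integral_norm_sub_sq_le (hI : IsReflectedIteration P f B M ξ G γ x0 xm1 x) {ν : ℝ}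
    (hν : 0 < ν) (hmono : IsStronglyMonotone ν (subdifferential f)) {c : ℝ≥0}
    (hc : ∀ n, ∀ᵐ ω ∂P, hI.condVar n ω ≤ c) (hγ : ∀ n, γ n = 1 / (2 * ν * ((n : ℝ) + 1)))
    {z : E} (hz : z ∈ zerSum (subdifferential f) B) :
    (∀ n, Integrable (fun ω => ‖x n ω - z‖ ^ 2) P) ∧
      ∃ C : ℝ, ∀ n : ℕ, 1 ≤ n →
        ∫ ω, ‖x n ω - z‖ ^ 2 ∂P ≤ C * (Real.log ((n : ℝ) + 1) / ((n : ℝ) + 1)) := by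
  have heL : ∀ n, MemLp (gradNoise B ξ G xm1 x n) 2 P := fun n => by
    have := hI.memLp_gradNoise (n := n) MeasurableSet.univ (K := c) ENNReal.coe_ne_top
      (by simpa using hc n)
    rwa [Measure.restrict_univ] at this
  have hL : ∀ n, MemLp (x n) 2 P ∧ MemLp (reflected xm1 x n) 2 P ∧ MemLp (x (n + 1)) 2 P :=
    fun n => by
      have := hI.memLp_aux (A := fun _ => univ) antitone_const
        (by simpa only [Measure.restrict_univ] using heL) n
      simpa only [Measure.restrict_univ] using this
  have hzL : MemLp (fun _ : Ω => z) 2 P := memLp_const z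
  have hxz : ∀ n, Integrable (fun ω => ‖x n ω - z‖ ^ 2) P := fun n =>
    ((hL n).1.sub hzL).integrable_norm_pow two_ne_zero
  refine ⟨hxz, ?_⟩
  set Φ : ℕ → Ω → ℝ := fun n ω => reflectedEnergy (2 * ν * ((n : ℝ) + 2)) (5 * M) M B z (x n ω)
    (x (n + 1) ω) (reflected xm1 x n ω) with hΦ
  have hΦi : ∀ n, Integrable (Φ n) P := fun n =>
    hI.integrable_reflectedEnergy (hL n).1 (hL n).2.2 (hL n).2.1 _ _ _ _
  have hM0 : (0 : ℝ) ≤ M := M.2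
  have hs2 : √2 ≤ 4 := by rw [Real.sqrt_le_left] <;> norm_num
  -- the error term in the energy inequality is of order `1 / n`
  have hnoise : ∀ n, -∫ ω, ⟪x (n + 1) ω - z, gradNoise B ξ G xm1 x n ω⟫ ∂P ≤
      γ n * c := by
    intro n
    have h1 := hI.neg_setIntegral_inner_le (n := n) MeasurableSet.univ
      (v := fun _ => -z) measurable_const (memLp_const _)
      (by simpa using (hL n).1) (by simpa using (hL n).2.1) (by simpa using heL n)
    have h2 := hI.setIntegral_norm_gradNoise_sq (n := n) MeasurableSet.univ (K := c)
      ENNReal.coe_ne_top (by simpa using hc n)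
    simp only [Measure.restrict_univ, ← sub_eq_add_neg] at h1 h2
    refine h1.trans (mul_le_mul_of_nonneg_left ?_ (hI.step_pos n).le)
    rw [h2]
    calc ∫ ω, (hI.condVar n ω).toReal ∂P ≤ ∫ _, (c : ℝ) ∂P := by
          refine integral_mono_of_nonneg (Eventually.of_forall fun _ => ENNReal.toReal_nonneg)
            (integrable_const _) ?_
          filter_upwards [hc n] with ω hω
          exact ENNReal.toReal_le_of_le_ofReal c.2 (by simpa using hω)
      _ = c := by simp
  have hstep : ∀ n : ℕ, 7 * (M : ℝ) ≤ 2 * ν * ((n : ℝ) + 2) →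
      ∫ ω, Φ (n + 1) ω ∂P ≤ ∫ ω, Φ n ω ∂P + c / ν * (1 / ((n : ℝ) + 2)) := by
    intro n hn
    have hγn : γ (n + 1) = 1 / (2 * ν * ((n : ℝ) + 2)) := by
      rw [hγ]
      push_cast
      ring
    have hle : ∀ ω, Φ (n + 1) ω ≤
        Φ n ω - 2 * ⟪x (n + 2) ω - z, gradNoise B ξ G xm1 x (n + 1) ω⟫ := by
      intro ω
      have h1 := hmono _ _ _ (hI.mem_subdifferential (n + 1) ω) _ (neg_mem_of_mem_zerSum hz)
      rw [sub_neg_eq_add, hγn, one_div, inv_inv] at h1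
      have h2 := reflectedEnergy_succ_le_of_stronglyMonotone (y := reflected xm1 x n ω)
        (a := x n ω) hM0 hI.norm_sub_le hI.monotone hn rfl h1
      have h3 : (2 * ν * ((n : ℝ) + 2)) + 2 * ν = 2 * ν * (((n + 1 : ℕ) : ℝ) + 2) := by
        push_cast
        ring
      rw [h3] at h2
      exact h2
    have hi : Integrable (fun ω => ⟪x (n + 2) ω - z, gradNoise B ξ G xm1 x (n + 1) ω⟫) P :=
      ((hL (n + 2)).1.sub hzL).integrable_real_inner (heL (n + 1))
    have h1 := integral_mono (hΦi (n + 1)) ((hΦi n).sub (hi.const_mul 2)) hle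
    have h2 := hnoise (n + 1)
    simp only [Pi.sub_apply] at h1
    rw [integral_sub (hΦi n) (hi.const_mul 2), integral_const_mul] at h1
    rw [hγn] at h2
    have h3 : c / ν * (1 / ((n : ℝ) + 2)) = 2 * (1 / (2 * ν * ((n : ℝ) + 2)) * c) := by
      field_simp
    rw [h3]
    linarith
  obtain ⟨N, hN⟩ := exists_nat_ge (7 * (M : ℝ) / (2 * ν))
  have hN' : ∀ n : ℕ, N ≤ n → 7 * (M : ℝ) ≤ 2 * ν * ((n : ℝ) + 2) := by
    intro n hn
    rw [div_le_iff₀ (by positivity)] at hN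
    have : (N : ℝ) ≤ n := by exact_mod_cast hn
    nlinarith
  have hsum : ∀ n : ℕ, N ≤ n →
      ∫ ω, Φ n ω ∂P ≤ |∫ ω, Φ N ω ∂P| + c / ν * Real.log ((n : ℝ) + 1) := by
    intro n hn
    induction n, hn using Nat.le_induction with
    | base =>
      have : 0 ≤ c / ν * Real.log ((N : ℝ) + 1) :=
        mul_nonneg (by positivity) (Real.log_nonneg (by linarith [(Nat.cast_nonneg N : (0:ℝ) ≤ N)]))
      linarith [le_abs_self (∫ ω, Φ N ω ∂P)]
    | succ n hn ih =>
      have h1 := hstep n (hN' n hn)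
      have h2 := mul_le_mul_of_nonneg_left (one_div_add_two_le_log_sub_log n)
        (show 0 ≤ c / ν by positivity)
      push_cast
      rw [show (n : ℝ) + 1 + 1 = n + 2 by ring]
      linarith
  refine exists_forall_one_le_of_eventually (N := N + 1)
    (C := (|∫ ω, Φ N ω ∂P| / Real.log 2 + c / ν) / ν) (fun n hn => ?_) fun n hn => ?_
  · have : (1 : ℝ) ≤ n := by exact_mod_cast hn
    exact div_pos (Real.log_pos (by linarith)) (by linarith)
  · obtain ⟨n, rfl⟩ : ∃ k, n = k + 1 := ⟨n - 1, by omega⟩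
    have hn' : N ≤ n := by omega
    have hα := hN' n hn'
    have h1 : ∫ ω, 2 * ν * ((n : ℝ) + 2) / 2 * ‖x (n + 1) ω - z‖ ^ 2 ∂P ≤ ∫ ω, Φ n ω ∂P :=
      integral_mono ((hxz (n + 1)).const_mul _) (hΦi n) fun ω =>
        half_mul_norm_sq_le_reflectedEnergy hM0 hI.norm_sub_le (by nlinarith) (by nlinarith) _ _ _ _
    rw [integral_const_mul] at h1
    have h2 := hsum n hn'
    have hn0 : (0 : ℝ) ≤ n := n.cast_nonneg
    have hlog2 : 0 < Real.log 2 := Real.log_pos (by norm_num)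
    have h3 : Real.log ((n : ℝ) + 1) ≤ Real.log ((n : ℝ) + 2) :=
      Real.log_le_log (by positivity) (by linarith)
    have h4 : Real.log 2 ≤ Real.log ((n : ℝ) + 2) := Real.log_le_log (by norm_num) (by linarith)
    have h5 : |∫ ω, Φ N ω ∂P| ≤ |∫ ω, Φ N ω ∂P| / Real.log 2 * Real.log ((n : ℝ) + 2) := by
      rw [div_mul_eq_mul_div, le_div_iff₀ hlog2]
      exact mul_le_mul_of_nonneg_left h4 (abs_nonneg _)
    have h6 := mul_le_mul_of_nonneg_left h3 (show 0 ≤ c / ν by positivity)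
    push_cast
    rw [show (n : ℝ) + 1 + 1 = n + 2 by ring, ← mul_div_assoc, le_div_iff₀ (by positivity),
      div_mul_eq_mul_div, le_div_iff₀ hν]
    linarith

end IsReflectedIteration

end StronglyMonotone

/-! ### Weak convergence in the general case -/

lemma measurable_norm_sq {E : Type*} [NormedAddCommGroup E] [MeasurableSpace E] [BorelSpace E]
    {Ω : Type*} {m : MeasurableSpace Ω} {g : Ω → E} (hg : Measurable g) :
    Measurable fun ω => ‖g ω‖ ^ 2 :=
  hg.norm.pow_const 2

/-- The sum of a sequence that is stopped as soon as its partial sums exceed `K` is at most `K`.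
The indices are shifted since the process to which this applies starts at time `1`. -/
lemma sum_range_indicator_toReal_le (a : ℕ → ℝ≥0∞) {K : ℝ≥0} (N : ℕ) :
    ∑ k ∈ Finset.range N,
      {k | ∑ j ∈ Finset.range (k + 2), a j ≤ K}.indicator (fun k => (a (k + 1)).toReal) k ≤ K := by
  induction N with
  | zero => simp
  | succ N ih =>
    by_cases hN : ∑ j ∈ Finset.range (N + 2), a j ≤ K
    · have hfin : ∀ j ∈ Finset.range (N + 2), a j ≠ ∞ := fun j hj =>
        ne_top_of_le_ne_top (ne_top_of_le_ne_top ENNReal.coe_ne_top hN)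
          (Finset.single_le_sum (f := a) (fun _ _ => zero_le) hj)
      calc ∑ k ∈ Finset.range (N + 1), {k | ∑ j ∈ Finset.range (k + 2), a j ≤ K}.indicator
            (fun k => (a (k + 1)).toReal) k
          ≤ ∑ k ∈ Finset.range (N + 1), (a (k + 1)).toReal :=
            Finset.sum_le_sum fun k _ => indicator_le_self' (fun _ _ => ENNReal.toReal_nonneg) k
        _ ≤ ∑ j ∈ Finset.range (N + 2), (a j).toReal := by
            rw [Finset.sum_range_succ' _ (N + 1)]
            linarith [ENNReal.toReal_nonneg (a := a 0)]
        _ = (∑ j ∈ Finset.range (N + 2), a j).toReal := (ENNReal.toReal_sum hfin).symm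
        _ ≤ K := ENNReal.toReal_le_of_le_ofReal K.2 (by simpa using hN)
    · rw [Finset.sum_range_succ, indicator_of_notMem (by simpa using hN), add_zero]
      exact ih

section Deterministic

variable {E : Type*} [NormedAddCommGroup E] [InnerProductSpace ℝ E]

/-- If the energy converges and the increments vanish, then the distance to `z` converges. -/
lemma exists_tendsto_norm_sub_of_reflectedEnergy {B : E → E} {M : ℝ} (hM : 0 ≤ M)
    (hB : ∀ a b, ‖B a - B b‖ ≤ M * ‖a - b‖) {α : ℕ → ℝ} {α' : ℝ} (hα' : 0 < α')
    (hα : Tendsto α atTop (𝓝 α')) (hMα : ∀ n, M * (1 + √2) ≤ α n) (hαpos : ∀ n, α' ≤ α n)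
    {X Y : ℕ → E} {z : E} {r : ℝ}
    (hd : Tendsto (fun n => X (n + 1) - X n) atTop (𝓝 0))
    (hy : Tendsto (fun n => X (n + 1) - Y n) atTop (𝓝 0))
    (hΦ : Tendsto (fun n => reflectedEnergy (α n) (α n + M * (1 + √2)) M B z (X n) (X (n + 1))
      (Y n)) atTop (𝓝 r)) :
    ∃ r, Tendsto (fun n => ‖X n - z‖) atTop (𝓝 r) := by
  obtain ⟨R, hR⟩ := hΦ.bddAbove_range
  have hbdd : ∀ n, ‖X (n + 1) - z‖ ^ 2 ≤ 2 * R / α' := by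
    intro n
    have h0 := hαpos n
    have h1 : reflectedEnergy (α n) (α n + M * (1 + √2)) M B z (X n) (X (n + 1)) (Y n) ≤ R :=
      hR ⟨n, rfl⟩
    have h2 := half_mul_norm_sq_le_reflectedEnergy hM hB (hMα n)
      (show M * (1 + √2) ≤ α n + M * (1 + √2) by linarith) z (X n) (X (n + 1)) (Y n)
    rw [le_div_iff₀ hα']
    nlinarith [mul_le_mul_of_nonneg_right h0 (sq_nonneg ‖X (n + 1) - z‖)]
  have hinner : Tendsto (fun n => ⟪X (n + 1) - X n, B (Y n) - B z⟫) atTop (𝓝 0) := by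
    have h1 : Tendsto (fun n => ‖X (n + 1) - X n‖ * (M * (√(2 * R / α') + ‖X (n + 1) - Y n‖)))
        atTop (𝓝 0) := by
      simpa using hd.norm.mul ((hy.norm.const_add (√(2 * R / α'))).const_mul M)
    refine squeeze_zero_norm (fun n => ?_) h1
    refine (norm_inner_le_norm _ _).trans ?_
    gcongr
    refine (hB _ _).trans ?_
    gcongr
    have h3 : ‖X (n + 1) - z‖ ≤ √(2 * R / α') := Real.le_sqrt_of_sq_le (hbdd n)
    have h4 : X (n + 1) - z - (X (n + 1) - Y n) = Y n - z := by abel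
    have h5 := norm_sub_le (X (n + 1) - z) (X (n + 1) - Y n)
    rw [h4] at h5
    linarith
  have hmain : Tendsto (fun n => α n * ‖X (n + 1) - z‖ ^ 2) atTop
      (𝓝 (r - 2 * 0 - (α' + M * (1 + √2)) * ‖(0 : E)‖ ^ 2 - M * ‖(0 : E)‖ ^ 2)) := by
    refine (((hΦ.sub (hinner.const_mul 2)).sub ((hα.add_const (M * (1 + √2))).mul
      (hd.norm.pow 2))).sub ((hy.norm.pow 2).const_mul M)).congr fun n => ?_
    unfold reflectedEnergy
    ring
  have hdiv := hmain.div hα hα'.ne'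
  have hsqrt := (Real.continuous_sqrt.tendsto _).comp hdiv
  refine ⟨_, (tendsto_add_atTop_iff_nat 1).1 (hsqrt.congr fun n => ?_)⟩
  have hn : α n ≠ 0 := (hα'.trans_le (hαpos n)).ne'
  simp only [Function.comp_apply, Pi.div_apply]
  rw [mul_div_cancel_left₀ _ hn, Real.sqrt_sq (norm_nonneg _)]

end Deterministic

section Measurability

variable {E : Type*} [NormedAddCommGroup E] [InnerProductSpace ℝ E] [CompleteSpace E]
  [SecondCountableTopology E] [MeasurableSpace E] [BorelSpace E]

/-- An almost sure weak limit can be chosen measurable, with values in a prescribed set. The map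
that sends a point to its inner products with a dense sequence is a measurable embedding, by the
Lusin–Souslin theorem. -/
lemma exists_measurable_weak_limit {Ω : Type*} {mΩ : MeasurableSpace Ω} {P : Measure Ω}
    {x : ℕ → Ω → E} (hx : ∀ n, Measurable (x n)) {Z : Set E} (hZ : Z.Nonempty)
    (hlim : ∀ᵐ ω ∂P, ∃ p ∈ Z, ∀ v, Tendsto (fun n => ⟪x n ω, v⟫) atTop (𝓝 ⟪p, v⟫)) :
    ∃ xbar : Ω → E, Measurable xbar ∧ (∀ ω, xbar ω ∈ Z) ∧
      ∀ᵐ ω ∂P, ∀ v, Tendsto (fun n => ⟪x n ω, v⟫) atTop (𝓝 ⟪xbar ω, v⟫) := by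
  classical
  obtain ⟨z, hz⟩ := hZ
  obtain ⟨t, hts, htm, ht0⟩ := exists_measurable_superset_of_null hlim
  have hgood : ∀ ω, ω ∉ t → ∃ p ∈ Z, ∀ v, Tendsto (fun n => ⟪x n ω, v⟫) atTop (𝓝 ⟪p, v⟫) :=
    fun ω hω => by
      by_contra hcon
      exact hω (hts hcon)
  choose! g hgZ hg using hgood
  refine ⟨fun ω => if ω ∈ t then z else g ω, ?_, fun ω => ?_, ?_⟩
  · let T : E → ℕ → ℝ := fun p k => ⟪p, TopologicalSpace.denseSeq E k⟫
    have hTc : Continuous T := continuous_pi fun k => continuous_id.inner continuous_const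
    have hTi : Function.Injective T := by
      intro p q hpq
      refine ext_inner_right ℝ fun v => ?_
      have h1 : (fun v => ⟪p, v⟫) = fun v => ⟪q, v⟫ :=
        Continuous.ext_on (TopologicalSpace.denseRange_denseSeq E)
          (continuous_const.inner continuous_id)
          (continuous_const.inner continuous_id) (by
            rintro _ ⟨k, rfl⟩
            exact congrFun hpq k)
      exact congrFun h1 v
    have hTe : MeasurableEmbedding T := hTc.measurableEmbedding hTi
    refine hTe.measurable_comp_iff.1 (measurable_pi_lambda _ fun k => ?_)
    refine measurable_of_tendsto_metrizable
      (f := fun n ω => if ω ∈ t then ⟪z, TopologicalSpace.denseSeq E k⟫ else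
        ⟪x n ω, TopologicalSpace.denseSeq E k⟫)
      (fun n => Measurable.ite htm measurable_const ((hx n).inner measurable_const)) ?_
    rw [tendsto_pi_nhds]
    intro ω
    by_cases hω : ω ∈ t
    · simp [T, hω]
    · simpa [T, hω] using hg ω hω (TopologicalSpace.denseSeq E k)
  · by_cases hω : ω ∈ t
    · simpa [hω] using hz
    · simpa [hω] using hgZ ω hω
  · filter_upwards [measure_eq_zero_iff_ae_notMem.1 ht0] with ω hω
    simpa [hω] using hg ω hω

end Measurability

namespace IsReflectedIteration

variable {E : Type*} [NormedAddCommGroup E] [InnerProductSpace ℝ E] [MeasurableSpace E]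
  {Ω : Type*} {mΩ : MeasurableSpace Ω} {S : Type*} [MeasurableSpace S]
  {P : Measure Ω} {f : E → EReal} {B : E → E} {M : ℝ≥0}
  {ξ : ℕ → Ω → S} {G : E → S → E} {γ : ℕ → ℝ} {x0 xm1 : E} {x : ℕ → Ω → E}

/-- The event that the conditional variances up to time `n` sum up to at most `K`. -/
def varBounded (hI : IsReflectedIteration P f B M ξ G γ x0 xm1 x) (K : ℝ≥0) (n : ℕ) : Set Ω :=
  {ω | ∑ k ∈ Finset.range (n + 1), hI.condVar k ω ≤ K}

lemma antitone_varBounded (hI : IsReflectedIteration P f B M ξ G γ x0 xm1 x) (K : ℝ≥0) :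
    Antitone (hI.varBounded K) := by
  intro n k hnk ω hω
  have h : ∑ j ∈ Finset.range (n + 1), hI.condVar j ω ≤
      ∑ j ∈ Finset.range (k + 1), hI.condVar j ω :=
    Finset.sum_le_sum_of_subset (Finset.range_mono (by omega))
  exact h.trans hω

lemma condVar_le_of_mem_varBounded (hI : IsReflectedIteration P f B M ξ G γ x0 xm1 x) {K : ℝ≥0}
    {n : ℕ} {ω : Ω} (hω : ω ∈ hI.varBounded K n) : hI.condVar n ω ≤ K :=
  le_trans (Finset.single_le_sum (f := fun k => hI.condVar k ω) (fun _ _ => zero_le)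
    (Finset.self_mem_range_succ n)) hω

lemma measurable_condVar (hI : IsReflectedIteration P f B M ξ G γ x0 xm1 x) (n : ℕ) :
    Measurable[pastSigma ξ n] (hI.condVar n) :=
  measurable_condLExp _ _ _

lemma measurableSet_varBounded (hI : IsReflectedIteration P f B M ξ G γ x0 xm1 x) (K : ℝ≥0)
    (n : ℕ) : MeasurableSet[pastSigma ξ n] (hI.varBounded K n) := by
  have h : Measurable[pastSigma ξ n] fun ω => ∑ k ∈ Finset.range (n + 1), hI.condVar k ω :=
    Finset.measurable_sum _ fun k hk => (hI.measurable_condVar k).mono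
      ((pastFiltration hI.measurable_sample).mono (Nat.lt_succ_iff.1 (Finset.mem_range.1 hk)))
      le_rfl
  exact h measurableSet_Iic

lemma exists_forall_mem_varBounded (hI : IsReflectedIteration P f B M ξ G γ x0 xm1 x) {ω : Ω}
    (h : ∑' n, hI.condVar n ω < ∞) : ∃ K : ℕ, ∀ n, ω ∈ hI.varBounded K n := by
  obtain ⟨K, hK⟩ := ENNReal.exists_nat_gt h.ne
  refine ⟨K, fun n => ?_⟩
  have : ∑ k ∈ Finset.range (n + 1), hI.condVar k ω ≤ (K : ℝ≥0∞) :=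
    (ENNReal.sum_le_tsum _).trans hK.le
  simpa [varBounded] using this

lemma mul_one_add_sqrt_two_le_inv (hI : IsReflectedIteration P f B M ξ G γ x0 xm1 x)
    (hγM : ∀ n, γ n * M < √2 - 1) (n : ℕ) : M * (1 + √2) ≤ (γ n)⁻¹ := by
  rw [← one_div, le_div_iff₀ (hI.step_pos n)]
  have h2 : √2 * √2 = 2 := Real.mul_self_sqrt (by norm_num)
  nlinarith [hγM n, Real.sqrt_nonneg 2]

lemma measurable_reflectedEnergy [SecondCountableTopology E] [BorelSpace E]
    (hI : IsReflectedIteration P f B M ξ G γ x0 xm1 x)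
    {Ω' : Type*} {m : MeasurableSpace Ω'} {a b y : Ω' → E} (ha : Measurable a) (hb : Measurable b)
    (hy : Measurable y) (α β K : ℝ) (z : E) :
    Measurable fun ω => reflectedEnergy α β K B z (a ω) (b ω) (y ω) := by
  have hBy : Measurable fun ω => B (y ω) := hI.lipschitz.continuous.measurable.comp hy
  exact ((((measurable_norm_sq (hb.sub measurable_const)).const_mul α).add
    (((hb.sub ha).inner (hBy.sub measurable_const)).const_mul 2)).add
    ((measurable_norm_sq (hb.sub ha)).const_mul β)).add
    ((measurable_norm_sq (hb.sub hy)).const_mul K)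

variable [CompleteSpace E]

/-- Pathwise energy decrease, with the noise split into square terms and a term that is almost
uncorrelated. -/
lemma reflectedEnergy_succ_add_le (hI : IsReflectedIteration P f B M ξ G γ x0 xm1 x)
    (hγ : Monotone γ) (hγM : ∀ n, γ n * M < √2 - 1) {τ : ℝ} (hτ : 0 < τ)
    (hτγ : ∀ n, τ ≤ 2 / γ (n + 1) - 1 / γ n - M * (1 + √2)) {z : E}
    (hz : z ∈ zerSum (subdifferential f) B) (n : ℕ) (ω : Ω) :
    reflectedEnergy (γ (n + 1))⁻¹ ((γ (n + 1))⁻¹ + M * (1 + √2)) M B z (x (n + 1) ω)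
        (x (n + 2) ω) (reflected xm1 x (n + 1) ω) + τ / 2 * ‖x (n + 2) ω - x (n + 1) ω‖ ^ 2 ≤
      reflectedEnergy (γ n)⁻¹ ((γ n)⁻¹ + M * (1 + √2)) M B z (x n ω) (x (n + 1) ω)
        (reflected xm1 x n ω) + 2 / τ * ‖gradNoise B ξ G xm1 x n ω‖ ^ 2 -
        4 * ⟪x (n + 2) ω + -(2 : ℝ)⁻¹ • (x (n + 1) ω + z), gradNoise B ξ G xm1 x (n + 1) ω⟫ := by
  have hα := hI.mul_one_add_sqrt_two_le_inv hγM n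
  have hα' : (γ (n + 1))⁻¹ ≤ (γ n)⁻¹ := inv_anti₀ (hI.step_pos n) (hγ n.le_succ)
  have h1 := hI.gammaZero.subdifferential_monotone (hI.mem_subdifferential (n + 1) ω)
    (neg_mem_of_mem_zerSum hz)
  rw [sub_neg_eq_add] at h1
  have h2 := hI.gammaZero.subdifferential_monotone (hI.mem_subdifferential (n + 1) ω)
    (hI.mem_subdifferential n ω)
  have h3 := reflectedEnergy_succ_le (y' := reflected xm1 x (n + 1) ω) M.coe_nonneg
    hI.norm_sub_le hI.monotone hα hα' rfl h1 h2
  have h4 := hτγ n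
  rw [one_div, div_eq_mul_inv] at h4
  have h5 := mul_le_mul_of_nonneg_right h4 (sq_nonneg ‖x (n + 2) ω - x (n + 1) ω‖)
  set d := x (n + 2) ω - x (n + 1) ω with hd
  set e := gradNoise B ξ G xm1 x n ω
  set e' := gradNoise B ξ G xm1 x (n + 1) ω
  have h6 : 2 * ⟪d, e⟫ ≤ τ / 2 * ‖d‖ ^ 2 + 2 / τ * ‖e‖ ^ 2 := by
    have h7 := real_inner_le_norm d e
    have h8 : τ / 2 * ‖d‖ ^ 2 + 2 / τ * ‖e‖ ^ 2 - 2 * (‖d‖ * ‖e‖) =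
        τ / 2 * (‖d‖ - 2 / τ * ‖e‖) ^ 2 := by
      field_simp
      ring
    have h9 : 0 ≤ τ / 2 * (‖d‖ - 2 / τ * ‖e‖) ^ 2 := by positivity
    linarith
  have h7 : 4 * ⟪x (n + 2) ω + -(2 : ℝ)⁻¹ • (x (n + 1) ω + z), e'⟫ =
      2 * ⟪x (n + 2) ω - z, e'⟫ + 2 * ⟪d, e'⟫ := by
    rw [hd]
    simp only [inner_add_left, inner_sub_left, inner_smul_left]
    simp
    ring
  rw [inner_sub_right] at h3
  have h8 : x (n + 1 + 1) ω = x (n + 2) ω := rfl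
  rw [h8] at h3
  linarith

variable [SecondCountableTopology E] [BorelSpace E]

variable [IsProbabilityMeasure P]

/-- On almost every path with summable conditional variances, the energy relative to a zero `z`
converges, and the increments and the noise are square summable. -/
lemma ae_tendsto_reflectedEnergy (hI : IsReflectedIteration P f B M ξ G γ x0 xm1 x)
    (hγ : Monotone γ) (hγM : ∀ n, γ n * M < √2 - 1) {τ : ℝ} (hτ : 0 < τ)
    (hτγ : ∀ n, τ ≤ 2 / γ (n + 1) - 1 / γ n - M * (1 + √2)) {Γ : ℝ} (hΓ : ∀ n, γ n ≤ Γ)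
    (hvar : ∀ᵐ ω ∂P, ∑' n, hI.condVar n ω < ∞) {z : E}
    (hz : z ∈ zerSum (subdifferential f) B) :
    ∀ᵐ ω ∂P, (∃ r, Tendsto (fun n => reflectedEnergy (γ n)⁻¹ ((γ n)⁻¹ + M * (1 + √2)) M B z
        (x n ω) (x (n + 1) ω) (reflected xm1 x n ω)) atTop (𝓝 r)) ∧
      Tendsto (fun n => x (n + 1) ω - x n ω) atTop (𝓝 0) ∧
      Tendsto (fun n => gradNoise B ξ G xm1 x n ω) atTop (𝓝 0) := by
  have hmono : ∀ i j, i ≤ j → pastSigma ξ i ≤ pastSigma ξ j := fun _ _ hij =>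
    (pastFiltration hI.measurable_sample).mono hij
  -- the first step has no predecessor, hence the shift of the filtration
  let ℱ : Filtration ℕ mΩ :=
    ⟨fun n => pastSigma ξ (n + 1), fun _ _ hij => hmono _ _ (by omega), fun n => hI.pastSigma_le _⟩
  set Φ : ℕ → Ω → ℝ := fun n ω => reflectedEnergy (γ n)⁻¹ ((γ n)⁻¹ + M * (1 + √2)) M B z (x n ω)
    (x (n + 1) ω) (reflected xm1 x n ω) with hΦ
  set U : ℕ → Ω → ℝ := fun n ω => Φ n ω + 2 / τ * ‖gradNoise B ξ G xm1 x n ω‖ ^ 2 with hU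
  set D : ℕ → Ω → ℝ := fun n ω => τ / 2 * ‖x (n + 2) ω - x (n + 1) ω‖ ^ 2 +
    ‖gradNoise B ξ G xm1 x (n + 1) ω‖ ^ 2 with hD
  have hΓ0 : 0 < Γ := (hI.step_pos 0).trans_le (hΓ 0)
  -- `κ` collects the weights of the squared error in `U (n + 1)`, in `D n`, and in the bound for
  -- the inner product of the error with the next iterate
  set κ : ℝ := 2 / τ + 1 + 4 * Γ with hκ
  have hκ0 : 0 ≤ κ := by positivity
  set v : ℕ → Ω → ℝ := fun n ω => κ * (hI.condVar (n + 1) ω).toReal with hv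
  have hα := hI.mul_one_add_sqrt_two_le_inv hγM
  have hΦ0 : ∀ n ω, 0 ≤ Φ n ω := fun n ω =>
    le_trans (mul_nonneg (by have := hI.step_pos n; positivity) (sq_nonneg _))
      (half_mul_norm_sq_le_reflectedEnergy M.coe_nonneg hI.norm_sub_le (hα n)
        (show M * (1 + √2) ≤ (γ n)⁻¹ + M * (1 + √2) by have := hI.step_pos n; simp; positivity)
        _ _ _ _)
  have hxm : ∀ n k, n ≤ k → Measurable[pastSigma ξ k] (x n) := fun n k h =>
    (hI.measurable_iterate n).mono (hmono _ _ h) le_rfl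
  have hem : ∀ n k, n + 1 ≤ k → Measurable[pastSigma ξ k] (gradNoise B ξ G xm1 x n) :=
    fun n k h => (hI.measurable_gradNoise n).mono (hmono _ _ h) le_rfl
  have hym : ∀ n k, n ≤ k → Measurable[pastSigma ξ k] (reflected xm1 x n) := fun n k h =>
    (hI.measurable_reflected n).mono (hmono _ _ h) le_rfl
  have hΦm : ∀ n, Measurable[pastSigma ξ (n + 1)] (Φ n) := by
    intro n
    exact hI.measurable_reflectedEnergy (hxm n (n + 1) (by omega)) (hxm (n + 1) (n + 1) le_rfl)
      (hym n (n + 1) (by omega)) _ _ _ _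
  have hUm : ∀ n, StronglyMeasurable[ℱ n] (U n) := fun n =>
    ((hΦm n).add ((measurable_norm_sq (hem n (n + 1) le_rfl)).const_mul _)).stronglyMeasurable
  have hDm : ∀ n, StronglyMeasurable[ℱ (n + 1)] (D n) := fun n =>
    (((measurable_norm_sq ((hxm (n + 2) (n + 2) le_rfl).sub
      (hxm (n + 1) (n + 2) (by omega)))).const_mul _).add
      (measurable_norm_sq (hem (n + 1) (n + 2) le_rfl))).stronglyMeasurable
  have hvm : ∀ n, StronglyMeasurable[ℱ n] (v n) := fun n =>
    ((hI.measurable_condVar (n + 1)).ennreal_toReal.const_mul κ).stronglyMeasurable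
  have key : ∀ K : ℕ, ∀ᵐ ω ∂P, (∀ n, ω ∈ hI.varBounded K (n + 1)) →
      (∃ r, Tendsto (fun n => U n ω) atTop (𝓝 r)) ∧ Summable (fun n => D n ω) := by
    intro K
    have hanti := hI.antitone_varBounded K
    have hAm := hI.measurableSet_varBounded K
    have hbd : ∀ n s, MeasurableSet[pastSigma ξ n] s → s ⊆ hI.varBounded K n →
        ∀ᵐ ω ∂P.restrict s, hI.condVar n ω ≤ (K : ℝ≥0) := fun n s hs hsA =>
      (ae_restrict_mem (hI.pastSigma_le n _ hs)).mono fun ω hω =>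
        hI.condVar_le_of_mem_varBounded (hsA hω)
    have heL : ∀ n, MemLp (gradNoise B ξ G xm1 x n) 2 (P.restrict (hI.varBounded K n)) := fun n =>
      hI.memLp_gradNoise (hAm n) ENNReal.coe_ne_top (hbd n _ (hAm n) le_rfl)
    have hL := hI.memLp_aux hanti heL
    have hUi : ∀ n, IntegrableOn (U n) (hI.varBounded K n) P := fun n =>
      (hI.integrable_reflectedEnergy (hL n).1 (hL n).2.2 (hL n).2.1 _ _ _ _).add
        (((heL n).integrable_norm_pow two_ne_zero).const_mul _)
    have hei : ∀ n, IntegrableOn (fun ω => ‖gradNoise B ξ G xm1 x n ω‖ ^ 2)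
        (hI.varBounded K n) P := fun n => (heL n).integrable_norm_pow two_ne_zero
    have hDi : ∀ n, IntegrableOn (D n) (hI.varBounded K (n + 1)) P := fun n =>
      ((((hL (n + 1)).2.2.sub (hL (n + 1)).1).integrable_norm_pow two_ne_zero).const_mul _).add
        (hei (n + 1))
    have hvi : ∀ n, IntegrableOn (v n) (hI.varBounded K (n + 1)) P := by
      intro n
      refine Integrable.const_mul ?_ κ
      refine Integrable.mono' (integrable_const (K : ℝ))
        ((hI.measurable_condVar (n + 1)).mono (hI.pastSigma_le _) le_rfl
          |>.ennreal_toReal.aestronglyMeasurable) ?_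
      filter_upwards [hbd (n + 1) _ (hAm (n + 1)) le_rfl] with ω hω
      rw [Real.norm_of_nonneg ENNReal.toReal_nonneg]
      exact ENNReal.toReal_le_of_le_ofReal (by positivity) (by simpa using hω)
    refine ae_tendsto_and_summable_of_almost_supermartingale (ℱ := ℱ)
      (A := fun n => hI.varBounded K (n + 1)) (fun _ _ h => hanti (by omega))
      (fun n => hAm (n + 1)) hUm hDm hvm
      (fun n ω => add_nonneg (hΦ0 n ω) (by positivity)) (fun n ω => by positivity)
      (fun n ω => mul_nonneg hκ0 ENNReal.toReal_nonneg)
      (fun n => (hUi n).mono_set (hanti n.le_succ)) (fun n => hUi (n + 1)) hDi hvi ?_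
      (K := κ * K) ?_
    · intro n s hs hsA
      have hs' : MeasurableSet[pastSigma ξ (n + 1)] s := hs
      have hres : P.restrict s ≤ P.restrict (hI.varBounded K (n + 1)) :=
        Measure.restrict_mono hsA le_rfl
      have hLs := hL (n + 1)
      have hw : MemLp (fun ω => -(2 : ℝ)⁻¹ • (x (n + 1) ω + z)) 2 (P.restrict s) :=
        ((hLs.1.mono_measure hres).add (memLp_const z)).const_smul (-(2 : ℝ)⁻¹)
      have hwm : Measurable[pastSigma ξ (n + 1)] fun ω => -(2 : ℝ)⁻¹ • (x (n + 1) ω + z) :=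
        ((hI.measurable_iterate (n + 1)).add_const z).const_smul (-(2 : ℝ)⁻¹)
      have hes := (heL (n + 1)).mono_measure hres
      have hn := hI.neg_setIntegral_inner_le hs' hwm hw (hLs.1.mono_measure hres)
        (hLs.2.1.mono_measure hres) hes
      have hvs := hI.setIntegral_norm_gradNoise_sq hs' ENNReal.coe_ne_top (hbd (n + 1) s hs' hsA)
      have hi1 : IntegrableOn (U n) s P := (hUi n).mono_set (hsA.trans (hanti n.le_succ))
      have hi2 : IntegrableOn (fun ω => ‖gradNoise B ξ G xm1 x (n + 1) ω‖ ^ 2) s P :=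
        (hei (n + 1)).mono_set hsA
      have hi3 : IntegrableOn (fun ω => ⟪x (n + 2) ω + -(2 : ℝ)⁻¹ • (x (n + 1) ω + z),
          gradNoise B ξ G xm1 x (n + 1) ω⟫) s P :=
        ((hLs.2.2.mono_measure hres).add hw).integrable_real_inner hes
      have hpt : ∀ ω, U (n + 1) ω + D n ω ≤ U n ω +
          (2 / τ + 1) * ‖gradNoise B ξ G xm1 x (n + 1) ω‖ ^ 2 -
          4 * ⟪x (n + 2) ω + -(2 : ℝ)⁻¹ • (x (n + 1) ω + z),
            gradNoise B ξ G xm1 x (n + 1) ω⟫ := by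
        intro ω
        have h1 := hI.reflectedEnergy_succ_add_le hγ hγM hτ hτγ hz n ω
        simp only [hU, hD, hΦ]
        linarith
      have h1 := integral_mono (((hUi (n + 1)).mono_set hsA).add ((hDi n).mono_set hsA))
        ((hi1.add (hi2.const_mul (2 / τ + 1))).sub (hi3.const_mul 4)) hpt
      have e1 : ∫ ω in s, (U n ω + (2 / τ + 1) * ‖gradNoise B ξ G xm1 x (n + 1) ω‖ ^ 2) ∂P =
          ∫ ω in s, U n ω ∂P +
            (2 / τ + 1) * ∫ ω in s, ‖gradNoise B ξ G xm1 x (n + 1) ω‖ ^ 2 ∂P :=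
        (integral_add hi1 (hi2.const_mul (2 / τ + 1))).trans (by rw [integral_const_mul])
      have e2 := integral_sub (hi1.add (hi2.const_mul (2 / τ + 1))) (hi3.const_mul 4)
      simp only [Pi.sub_apply, Pi.add_apply] at h1 e2
      rw [e2, e1, integral_const_mul] at h1
      rw [integral_add hi1 ((hvi n).mono_set hsA)]
      have h2 : ∫ ω in s, v n ω ∂P = κ * ∫ ω in s, (hI.condVar (n + 1) ω).toReal ∂P :=
        integral_const_mul _ _
      have h3 : 0 ≤ ∫ ω in s, (hI.condVar (n + 1) ω).toReal ∂P :=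
        integral_nonneg fun _ => ENNReal.toReal_nonneg
      have h4 := mul_le_mul_of_nonneg_right (hΓ (n + 1)) h3
      rw [h2, hκ]
      rw [hvs] at h1 hn
      linarith
    · intro ω N
      have h1 := sum_range_indicator_toReal_le (fun k => hI.condVar k ω) (K := K) N
      have h2 : ∀ k, (hI.varBounded K (k + 1)).indicator (v k) ω =
          κ * {k | ∑ j ∈ Finset.range (k + 2), hI.condVar j ω ≤ (K : ℝ≥0)}.indicator
            (fun k => (hI.condVar (k + 1) ω).toReal) k := by
        intro k
        by_cases hk : ω ∈ hI.varBounded K (k + 1)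
        · rw [indicator_of_mem hk, indicator_of_mem (by exact hk)]
        · rw [indicator_of_notMem hk, indicator_of_notMem (by exact hk), mul_zero]
      simp only [h2, ← Finset.mul_sum]
      exact mul_le_mul_of_nonneg_left (by simpa using h1) hκ0
  filter_upwards [hvar, ae_all_iff.2 key] with ω hω hkey
  obtain ⟨K, hK⟩ := hI.exists_forall_mem_varBounded hω
  obtain ⟨⟨r, hr⟩, hsum⟩ := hkey K fun n => hK (n + 1)
  have hD0 := hsum.tendsto_atTop_zero
  have he : Tendsto (fun n => gradNoise B ξ G xm1 x n ω) atTop (𝓝 0) := by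
    refine (tendsto_add_atTop_iff_nat 1).1 (tendsto_zero_iff_norm_tendsto_zero.2 ?_)
    have h1 : Tendsto (fun n => √(D n ω)) atTop (𝓝 0) := by
      have := (Real.continuous_sqrt.tendsto 0).comp hD0
      rwa [Real.sqrt_zero] at this
    refine squeeze_zero (fun _ => norm_nonneg _) (fun n => Real.le_sqrt_of_sq_le ?_) h1
    have : 0 ≤ τ / 2 * ‖x (n + 2) ω - x (n + 1) ω‖ ^ 2 := by positivity
    simp only [hD]
    linarith
  have hd : Tendsto (fun n => x (n + 1) ω - x n ω) atTop (𝓝 0) := by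
    refine (tendsto_add_atTop_iff_nat 1).1 (tendsto_zero_iff_norm_tendsto_zero.2 ?_)
    have h1 : Tendsto (fun n => √(2 / τ * D n ω)) atTop (𝓝 0) := by
      have := (Real.continuous_sqrt.tendsto (2 / τ * 0)).comp (hD0.const_mul (2 / τ))
      rwa [mul_zero, Real.sqrt_zero] at this
    refine squeeze_zero (fun _ => norm_nonneg _) (fun n => Real.le_sqrt_of_sq_le ?_) h1
    have h2 : 2 / τ * D n ω = ‖x (n + 2) ω - x (n + 1) ω‖ ^ 2 +
        2 / τ * ‖gradNoise B ξ G xm1 x (n + 1) ω‖ ^ 2 := by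
      simp only [hD]
      field_simp
    have h3 : 0 ≤ 2 / τ * ‖gradNoise B ξ G xm1 x (n + 1) ω‖ ^ 2 := by positivity
    rw [h2]
    linarith
  refine ⟨⟨r - 2 / τ * ‖(0 : E)‖ ^ 2, ?_⟩, hd, he⟩
  refine (hr.sub ((he.norm.pow 2).const_mul (2 / τ))).congr fun n => ?_
  simp only [hU]
  ring

end IsReflectedIteration

namespace IsReflectedIteration

variable {E : Type*} [NormedAddCommGroup E] [InnerProductSpace ℝ E] [CompleteSpace E]
  [SecondCountableTopology E] [MeasurableSpace E] [BorelSpace E]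
  {Ω : Type*} {mΩ : MeasurableSpace Ω} {S : Type*} [MeasurableSpace S]
  {P : Measure Ω} [IsProbabilityMeasure P] {f : E → EReal} {h : E → ℝ} {M : ℝ≥0}
  {ξ : ℕ → Ω → S} {G : E → S → E} {γ : ℕ → ℝ} {x0 xm1 : E} {x : ℕ → Ω → E}

/-- Almost sure weak convergence to a zero of `∂f + ∇h`. Only countably many zeros enter the almost
sure statement, so that the exceptional null set does not depend on the zero. -/
lemma ae_exists_weak_limit (hI : IsReflectedIteration P f (∇ h) M ξ G γ x0 xm1 x)
    (hc : ConvexOn ℝ univ h) (hd : Differentiable ℝ h)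
    (hγ : Monotone γ) (hγM : ∀ n, γ n * M < √2 - 1) {τ : ℝ} (hτ : 0 < τ)
    (hτγ : ∀ n, τ ≤ 2 / γ (n + 1) - 1 / γ n - M * (1 + √2))
    (hvar : ∀ᵐ ω ∂P, ∑' n, hI.condVar n ω < ∞) :
    ∀ᵐ ω ∂P, ∃ p ∈ zerSum (subdifferential f) (∇ h),
      ∀ v, Tendsto (fun n => ⟪x n ω, v⟫) atTop (𝓝 ⟪p, v⟫) := by
  have hΓ : ∀ n, γ n ≤ 2 / τ := by
    intro n
    refine (hγ n.le_succ).trans ?_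
    have h1 : 0 ≤ 1 / γ n := one_div_nonneg.2 (hI.step_pos n).le
    have h2 : 0 ≤ M * (1 + √2) := by positivity
    have h3 : τ ≤ 2 / γ (n + 1) := by linarith [hτγ n]
    rw [le_div_iff₀ (hI.step_pos _)] at h3
    rw [le_div_iff₀ hτ]
    linarith
  have hanti : Antitone fun n => (γ n)⁻¹ := fun i j hij => inv_anti₀ (hI.step_pos i) (hγ hij)
  obtain ⟨α', hα'⟩ : ∃ α', Tendsto (fun n => (γ n)⁻¹) atTop (𝓝 α') :=
    ⟨_, tendsto_atTop_ciInf hanti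
      ⟨0, by rintro _ ⟨n, rfl⟩; exact (inv_pos.2 (hI.step_pos n)).le⟩⟩
  have hα'pos : 0 < α' := by
    refine lt_of_lt_of_le (show 0 < τ / 2 by positivity) (ge_of_tendsto' hα' fun n => ?_)
    rw [← inv_div]
    exact inv_anti₀ (hI.step_pos n) (hΓ n)
  obtain ⟨Z₀, hZ₀, hZ₀c, hZ₀d⟩ :=
    (TopologicalSpace.IsSeparable.of_separableSpace
      (zerSum (subdifferential f) (∇ h))).exists_countable_dense_subset
  have hae := (ae_ball_iff hZ₀c).2 fun z hz =>
    hI.ae_tendsto_reflectedEnergy hγ hγM hτ hτγ hΓ hvar (hZ₀ hz)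
  obtain ⟨z, hz⟩ := hI.nonempty
  filter_upwards [hae, hI.ae_tendsto_reflectedEnergy hγ hγM hτ hτγ hΓ hvar hz] with ω hω hω'
  obtain ⟨-, hinc, hnoise⟩ := hω'
  have hxy : Tendsto (fun n => x (n + 1) ω - reflected xm1 x n ω) atTop (𝓝 0) := by
    refine (tendsto_add_atTop_iff_nat 1).1 ?_
    have h1 := ((tendsto_add_atTop_iff_nat 1).2 hinc).sub hinc
    rw [sub_zero] at h1
    refine h1.congr fun n => ?_
    simp only [reflected]
    module
  have hdist : ∀ w ∈ zerSum (subdifferential f) (∇ h),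
      ∃ r, Tendsto (fun n => ‖x n ω - w‖) atTop (𝓝 r) := by
    refine exists_tendsto_norm_sub_of_subset_closure hZ₀d fun w hw => ?_
    obtain ⟨⟨r, hr⟩, -, -⟩ := hω w hw
    exact exists_tendsto_norm_sub_of_reflectedEnergy M.coe_nonneg hI.norm_sub_le hα'pos hα'
      (hI.mul_one_add_sqrt_two_le_inv hγM) (fun n => hanti.le_of_tendsto hα' n)
      (X := fun n => x n ω)
      (Y := fun n => reflected xm1 x n ω) hinc hxy hr
  obtain ⟨r, hr⟩ := hdist z hz
  obtain ⟨R, hR⟩ := hr.bddAbove_range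
  have hbdd : ∀ n, ‖x n ω‖ ≤ R + ‖z‖ := fun n => by
    have h1 : ‖x n ω - z‖ ≤ R := hR ⟨n, rfl⟩
    have h2 := norm_add_le (x n ω - z) z
    rw [sub_add_cancel] at h2
    linarith
  -- subgradients at the iterates; the value at `0` plays no role
  let u : ℕ → E := fun n => Nat.casesOn n 0 fun n =>
    (γ n)⁻¹ • (x n ω - x (n + 1) ω) - ∇ h (reflected xm1 x n ω) - gradNoise (∇ h) ξ G xm1 x n ω
  have hu : ∀ᶠ n in atTop, u n ∈ subdifferential f (x n ω) := by
    filter_upwards [eventually_ge_atTop 1] with n hn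
    obtain ⟨n, rfl⟩ : ∃ k, n = k + 1 := ⟨n - 1, by omega⟩
    exact hI.mem_subdifferential n ω
  have hu0 : Tendsto (fun n => u n + ∇ h (x n ω)) atTop (𝓝 0) := by
    refine (tendsto_add_atTop_iff_nat 1).1 ?_
    have h1 : Tendsto (fun n => ∇ h (x (n + 1) ω) - ∇ h (reflected xm1 x n ω)) atTop (𝓝 0) := by
      refine squeeze_zero_norm (fun n => hI.norm_sub_le _ _) ?_
      simpa using hxy.norm.const_mul (M : ℝ)
    have h2 := ((hα'.smul hinc.neg).add h1).sub hnoise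
    simp only [neg_zero, smul_zero, add_zero, sub_zero] at h2
    refine h2.congr fun n => ?_
    simp only [u, neg_sub]
    abel
  refine exists_tendsto_inner_of_opial ⟨z, hz⟩ hdist fun l p hl hp => ?_
  exact mem_zerSum_of_tendsto hI.gammaZero hc hd hbdd hp (hu.filter_mono hl) (hu0.mono_left hl)

end IsReflectedIteration

theorem corollary3p7
    {E : Type*} [NormedAddCommGroup E] [InnerProductSpace ℝ E] [CompleteSpace E]
    [TopologicalSpace.SeparableSpace E] [MeasurableSpace E] [BorelSpace E]
    {Ω : Type*} [MeasurableSpace Ω] (P : Measure Ω) [IsProbabilityMeasure P]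
    -- the set supporting the random vector, and the law of the random vector
    {m : ℕ} (ΩP : Set (EuclideanSpace ℝ (Fin m))) (ρ : Measure ΩP) [IsProbabilityMeasure ρ]
    -- the objective `f + h`
    (f : E → EReal) (hf : IsGammaZero f)
    (h : E → ℝ) (hconv : ConvexOn ℝ univ h) (hdiff : Differentiable ℝ h)
    (μ : ℝ≥0) (hlip : LipschitzWith μ (∇ h))
    (H : E → ΩP → ℝ) (H_conv : ∀ s, ConvexOn ℝ univ (fun x => H x s))
    (H_int : ∀ x, Integrable (H x) ρ) (hH : ∀ x, h x = ∫ s, H x s ∂ρ)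
    (hzer : (zerSum (subdifferential f) (∇ h)).Nonempty)
    -- i.i.d. samples
    (ξ : ℕ → Ω → ΩP) (ξ_meas : ∀ n, Measurable (ξ n)) (ξ_law : ∀ n, P.map (ξ n) = ρ)
    (ξ_indep : iIndepFun ξ P)
    -- unbiased stochastic gradients `∇H(x, s)`
    (gradH : E → ΩP → E) (gradH_meas : Measurable (Function.uncurry gradH))
    (gradH_int : ∀ x, Integrable (gradH x) ρ) (gradH_mean : ∀ x, ∫ s, gradH x s ∂ρ = ∇ h x)
    -- the algorithm
    (γ : ℕ → ℝ) (γ_pos : ∀ n, 0 < γ n) (x0 xm1 : E) (x : ℕ → Ω → E)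
    (x_zero : ∀ ω, x 0 ω = x0)
    (x_succ : ∀ n ω, IsProx (fun p => (γ n : EReal) * f p)
      (x n ω - γ n • gradH (reflected xm1 x n ω) (ξ n ω)) (x (n + 1) ω)) :
    -- strongly monotone case
    (∀ (ν : ℝ) (c : ℝ≥0), 0 < ν → IsStronglyMonotone ν (subdifferential f) →
      (∀ n, ∀ᵐ ω ∂P,
        P⁻[fun ω' => ‖gradH (reflected xm1 x n ω') (ξ n ω') - ∇ h (reflected xm1 x n ω')‖ₑ ^ 2 |
          pastSigma ξ n] ω ≤ (c : ℝ≥0∞)) →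
      (∀ n, γ n = 1 / (2 * ν * ((n : ℝ) + 1))) →
      ∃ xbar : E, {z | IsMinOn (fun y => f y + (h y : EReal)) univ z} = {xbar} ∧
        ∀ n₀ : ℕ, IsLeast {k : ℕ | 2 * ν⁻¹ * μ * (1 + √2) < k} n₀ →
          ∃ C : ℝ, ∀ n, n₀ < n →
            Integrable (fun ω => ‖x n ω - xbar‖ ^ 2) P ∧
            ∫ ω, ‖x n ω - xbar‖ ^ 2 ∂P ≤ C * (Real.log ((n : ℝ) + 1) / ((n : ℝ) + 1)))
    ∧
    -- general case
    (Monotone γ → (∀ n, γ n * μ < √2 - 1) →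
      (∃ τ > 0, ∀ n, τ ≤ 2 / γ (n + 1) - 1 / γ n - μ * (1 + √2)) →
      (∀ᵐ ω ∂P, ∑' n,
        P⁻[fun ω' => ‖gradH (reflected xm1 x n ω') (ξ n ω') - ∇ h (reflected xm1 x n ω')‖ₑ ^ 2 |
          pastSigma ξ n] ω < ∞) →
      ∃ xbar : Ω → E, Measurable xbar ∧
        (∀ ω, xbar ω ∈ zerSum (subdifferential f) (∇ h)) ∧
        ∀ᵐ ω ∂P, Tendsto (fun n => toWeakSpace ℝ E (x n ω)) atTop
          (𝓝 (toWeakSpace ℝ E (xbar ω)))) := by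
  have : SecondCountableTopology E := UniformSpace.secondCountable_of_separable E
  have hI : IsReflectedIteration P f (∇ h) μ ξ gradH γ x0 xm1 x :=
    { gammaZero := hf
      lipschitz := hlip
      monotone := hconv.gradient_monotone hdiff
      nonempty := hzer
      measurable_sample := ξ_meas
      indep := ξ_indep
      measurable_estimator := gradH_meas
      integrable_estimator := fun n q => by rw [ξ_law]; exact gradH_int q
      integral_estimator := fun n q => by rw [ξ_law]; exact gradH_mean q
      step_pos := γ_pos
      zero_eq := x_zero
      succ_isProx := x_succ }
  refine ⟨fun ν c hν hmono hvar hγ => ?_, fun hγ hγμ hτ hvar => ?_⟩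
  · obtain ⟨z, hz⟩ := hzer
    refine ⟨z, isMinOn_eq_singleton_of_isStronglyMonotone hf hconv hdiff hν hmono hz,
      fun n₀ hn₀ => ?_⟩
    obtain ⟨hint, C, hC⟩ := hI.integral_norm_sub_sq_le hν hmono hvar hγ hz
    -- the bound holds for all `n ≥ 1`; at `n = 0` its right-hand side vanishes
    exact ⟨C, fun n hn => ⟨hint n, hC n (by omega)⟩⟩
  · obtain ⟨τ, hτ, hτγ⟩ := hτ
    obtain ⟨xbar, hmeas, hmem, hlim⟩ := exists_measurable_weak_limit hI.measurable_iterate' hzer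
      (hI.ae_exists_weak_limit hconv hdiff hγ hγμ hτ hτγ hvar)
    exact ⟨xbar, hmeas, hmem, hlim.mono fun ω hω => tendsto_toWeakSpace_iff.2 hω⟩
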